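/- Setting. Let $p\ge 0$, $d=p+2$, and let $X_i=(1,X_{i2}',Q_i)'\in\mathbb R^d$ and $U_i\in\mathbb R$, $i\in\mathbb Z$, be random with $X_{i2}\in\mathbb R^{p}$, $Q_i\in\mathbb R$. For $\alpha=(\beta',\delta')'\in\mathbb R^{2d}$ with $\delta=(\delta_1,\delta_2',\delta_3)'$ partitioned as $X_i$, and $\tau\in\mathbb R$, put $X_i(\tau)=(X_i',X_i'\mathbb I\{Q_i>\tau\})'$ and $\theta=(\alpha',\tau)'$. The parameter space is $\Theta=\Lambda\times\mathbb T$ with $\Lambda\subset\mathbb R^{2d}$ and $\mathbb T\subset\mathbb R$ compact, it contains at least one point with $\delta_1+\delta_3\tau=0$, $\delta_2=0$, and the true parameter $\theta_0=(\alpha_0',\tau_0)'\in\Theta$ is fixed (it does not depend on $n$). The data are generated by $Y_i=X_i(\tau_0)'\alpha_0+U_i$. Assumption 1. $\{(X_i,U_i)\}_{i\in\mathbb Z}$ is strictly stationary and ergodic, its $\rho$-mixing coefficients satisfy $\sum_{m\ge1}\rho_m^{1/2}<\infty$, and $E(U_i\mid\mathcal F_{i-1})=0$, where $\mathcal F_{i-1}$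 is the $\sigma$-field generated by $X_j$, $j\le i$, and $U_j$, $j\le i-1$. The matrices $E(X_i(\tau_0)X_i(\tau_0)')$ and $E(X_i(\tau_0)X_i(\tau_0)'U_i^2)$ are positive definite, $E\|X_i\|^4<\infty$, $E\|X_iU_i\|^4<\infty$, and $E|U_i|^{4+\eta}<\infty$ for some $\eta>0$. Assumption 2. $Q_i$ has a Lebesgue density $f$, and there are versions of $f$ and of the conditional moments given $Q_i=\tau$ below such that: $f(\tau)$, $V(\tau)=E(X_iX_i'U_i^2\mid Q_i=\tau)$ and $D(\tau)=E(X_iX_i'\mid Q_i=\tau)$ are continuous at $\tau_0$; on $\mathbb T$ the functions $f(\tau)$, $E(X_iX_i'\mathbb I\{Q_i\le\tau\})$ and $\mathrm{Var}(X_{i2}\mid Q_i=\tau)$ are continuous and positive (positive definite, for matrices); and on $\mathbb T$ the functions $f(\tau)$, $E(|X_i|^4\mid Q_i=\tau)$ and $E(|X_iU_i|^4\mid Q_i=\tau)$ are bounded by some $C<\infty$. Test statistic. Let $\mathbb S_n(\theta)=\frac1n\sum_{i=1}^n(Y_i-X_i(\tau)'\alpha)^2$, let $\widehat\theta$ be any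 minimizer of $\mathbb S_n$ over $\Theta$, let $\widetilde\theta$ be any minimizer of $\mathbb S_n$ over $\{\theta\in\Theta:\delta_1+\delta_3\tau=0,\ \delta_2=0\}$, and let $$T_n=n\,\frac{\mathbb S_n(\widetilde\theta)-\mathbb S_n(\widehat\theta)}{\mathbb S_n(\widehat\theta)}.$$ Theorem. Under Assumptions 1 and 2 and the alternative hypothesis $H_1$: $\delta_{10}+\delta_{30}\tau_0\neq0$ and/or $\delta_{20}\neq0$, for every $c<\infty$, $$P\{T_n>c\}\to1\quad\text{as } n\to\infty .$$ -/

import Mathlib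

open MeasureTheory ProbabilityTheory Filter Topology
open scoped Matrix

noncomputable section

namespace ThresholdRegression

/-- Index set of the `d`-dimensional regressor `(1, x₂, q)`, where `x₂` has `p = d - 2` entries. -/
abbrev RegIdx (p : ℕ) : Type := Unit ⊕ (Fin p ⊕ Unit)

/-- Position of the intercept. -/
abbrev iOne {p : ℕ} : RegIdx p := Sum.inl ()

/-- Position of the `j`-th entry of `x₂`. -/
abbrev iMid {p : ℕ} (j : Fin p) : RegIdx p := Sum.inr (Sum.inl j)

/-- Position of the threshold variable `q`. -/
abbrev iThr {p : ℕ} : RegIdx p := Sum.inr (Sum.inr ())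

/-- Slope parameters `α = (β, δ)`: `β` is the left block and `δ` the right block. -/
abbrev Slope (p : ℕ) : Type := RegIdx p ⊕ RegIdx p → ℝ

/-- Parameters `θ = (α, τ)`. -/
abbrev Param (p : ℕ) : Type := Slope p × ℝ

/-- The regressor `x = (1, x₂, q)`. -/
def regressor {p : ℕ} (x₂ : Fin p → ℝ) (q : ℝ) : RegIdx p → ℝ :=
  Sum.elim (fun _ => 1) (Sum.elim x₂ (fun _ => q))

/-- The `2d`-dimensional regressor `x(τ) = (x, x 1{q > τ})`. -/
def regressorAt {p : ℕ} (x₂ : Fin p → ℝ) (q τ : ℝ) : RegIdx p ⊕ RegIdx p → ℝ :=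
  Sum.elim (regressor x₂ q) (fun a => if τ < q then regressor x₂ q a else 0)

/-- The regression function `x(τ)'α = x'β + x'δ 1{q > τ}`. -/
def regFun {p : ℕ} (θ : Param p) (x₂ : Fin p → ℝ) (q : ℝ) : ℝ :=
  regressorAt x₂ q θ.2 ⬝ᵥ θ.1

/-- The continuity (kink) restriction `δ₁ + δ₃ τ = 0` and `δ₂ = 0`. -/
def IsKink {p : ℕ} (θ : Param p) : Prop :=
  θ.1 (Sum.inr iOne) + θ.1 (Sum.inr iThr) * θ.2 = 0 ∧ ∀ j : Fin p, θ.1 (Sum.inr (iMid j)) = 0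

/-- The alternative hypothesis: `δ₁ + δ₃ τ ≠ 0` and/or `δ₂ ≠ 0`. -/
def IsJump {p : ℕ} (θ : Param p) : Prop :=
  θ.1 (Sum.inr iOne) + θ.1 (Sum.inr iThr) * θ.2 ≠ 0 ∨ ∃ j : Fin p, θ.1 (Sum.inr (iMid j)) ≠ 0

/-! ### Dependence -/

/-- Maximal correlation of two σ-algebras: the supremum of `|Corr(f, g)|` over square integrable
`f`, `g` measurable for `A` and for `B` respectively (constants have correlation `0`). -/
def maxCorr {Ω : Type*} [MeasurableSpace Ω] (P : Measure Ω) (A B : MeasurableSpace Ω) : ℝ :=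
  sSup {r : ℝ | ∃ f g : Ω → ℝ, Measurable[A] f ∧ Measurable[B] g ∧ MemLp f 2 P ∧ MemLp g 2 P ∧
    r = |covariance f g P| / (√(variance f P) * √(variance g P))}

/-- The ρ-mixing coefficient `ρ_m` of a process: the supremum over `k` of the maximal correlation
of `σ(Z_j : j ≤ k)` and `σ(Z_j : j ≥ k + m)`. -/
def rhoMixing {Ω E : Type*} [MeasurableSpace Ω] [mE : MeasurableSpace E] (P : Measure Ω)
    (Z : ℤ → Ω → E) (m : ℕ) : ℝ :=
  ⨆ k : ℤ, maxCorr P (⨆ j : Set.Iic k, mE.comap (Z j)) (⨆ j : Set.Ici (k + m), mE.comap (Z j))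

/-- The process is strictly stationary and ergodic: its law on path space is invariant and ergodic
under the shift. -/
def IsStationaryErgodic {Ω E : Type*} [MeasurableSpace Ω] [MeasurableSpace E] (P : Measure Ω)
    (Z : ℤ → Ω → E) : Prop :=
  Ergodic (fun (z : ℤ → E) (i : ℤ) => z (i + 1)) (P.map (fun ω (i : ℤ) => Z i ω))

section Model

variable {Ω : Type*} [MeasurableSpace Ω] {p : ℕ}

/-- The regressors `X_i = (1, X_{i2}, Q_i)`. -/
def X (X₂ : ℤ → Ω → Fin p → ℝ) (Q : ℤ → Ω → ℝ) (i : ℤ) (ω : Ω) : RegIdx p → ℝ :=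
  regressor (X₂ i ω) (Q i ω)

/-- The dependent variable `Y_i = X_i'β₀ + X_i'δ₀ 1{Q_i > τ₀} + U_i`. -/
def Y (θ₀ : Param p) (X₂ : ℤ → Ω → Fin p → ℝ) (Q U : ℤ → Ω → ℝ) (i : ℤ) (ω : Ω) : ℝ :=
  regFun θ₀ (X₂ i ω) (Q i ω) + U i ω

/-- The information up to time `i`: errors up to time `i`, and regressors up to time `i + 1`
(regressors are predetermined). -/
@[reducible] def history (X₂ : ℤ → Ω → Fin p → ℝ) (Q U : ℤ → Ω → ℝ) (i : ℤ) : MeasurableSpace Ω :=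
  ⨆ j : Set.Iic i,
    MeasurableSpace.comap (X X₂ Q (j + 1)) inferInstance ⊔
      MeasurableSpace.comap (U j) inferInstance

/-- `M = E(X_i(τ₀) X_i(τ₀)')`. -/
def momentM (P : Measure Ω) (X₂ : ℤ → Ω → Fin p → ℝ) (Q : ℤ → Ω → ℝ) (τ₀ : ℝ) :
    Matrix (RegIdx p ⊕ RegIdx p) (RegIdx p ⊕ RegIdx p) ℝ :=
  Matrix.of fun a b =>
    ∫ ω, regressorAt (X₂ 0 ω) (Q 0 ω) τ₀ a * regressorAt (X₂ 0 ω) (Q 0 ω) τ₀ b ∂P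

/-- `Ω = E(X_i(τ₀) X_i(τ₀)' U_i²)`. -/
def momentOmega (P : Measure Ω) (X₂ : ℤ → Ω → Fin p → ℝ) (Q U : ℤ → Ω → ℝ) (τ₀ : ℝ) :
    Matrix (RegIdx p ⊕ RegIdx p) (RegIdx p ⊕ RegIdx p) ℝ :=
  Matrix.of fun a b =>
    ∫ ω, regressorAt (X₂ 0 ω) (Q 0 ω) τ₀ a * regressorAt (X₂ 0 ω) (Q 0 ω) τ₀ b * U 0 ω ^ 2 ∂P

/-- `E(X_i X_i' 1{Q_i ≤ τ})`. -/
def lowerMoment (P : Measure Ω) (X₂ : ℤ → Ω → Fin p → ℝ) (Q : ℤ → Ω → ℝ) (τ : ℝ) :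
    Matrix (RegIdx p) (RegIdx p) ℝ :=
  Matrix.of fun a b => ∫ ω in {ω | Q 0 ω ≤ τ}, X X₂ Q 0 ω a * X X₂ Q 0 ω b ∂P

/-- Stationarity, mixing, the martingale difference property and moments. -/
structure DependenceAssumption (P : Measure Ω) (X₂ : ℤ → Ω → Fin p → ℝ) (Q U : ℤ → Ω → ℝ)
    (τ₀ : ℝ) : Prop where
  stationary_ergodic : IsStationaryErgodic P (fun i ω => (X X₂ Q i ω, U i ω))
  mixing : Summable fun m : ℕ => √(rhoMixing P (fun i ω => (X X₂ Q i ω, U i ω)) (m + 1))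
  martingale_difference : ∀ i : ℤ, P[U i | history X₂ Q U (i - 1)] =ᵐ[P] 0
  posDef_M : (momentM P X₂ Q τ₀).PosDef
  posDef_Omega : (momentOmega P X₂ Q U τ₀).PosDef
  moment_X : Integrable (fun ω => ‖WithLp.toLp 2 (X X₂ Q 0 ω)‖ ^ 4) P
  moment_XU : Integrable (fun ω => ‖WithLp.toLp 2 (U 0 ω • X X₂ Q 0 ω)‖ ^ 4) P
  moment_U : ∃ η : ℝ, 0 < η ∧ Integrable (fun ω => |U 0 ω| ^ (4 + η)) P

/-- `f` is a Lebesgue density of the real random variable `q`. -/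
def IsDensity (P : Measure Ω) (q : Ω → ℝ) (f : ℝ → ℝ) : Prop :=
  Measurable f ∧ (∀ t, 0 ≤ f t) ∧ P.map q = volume.withDensity (fun t => ENNReal.ofReal (f t))

/-- `w` is a version of the conditional expectation `τ ↦ E(W | q = τ)`. -/
def IsCondMean (P : Measure Ω) (q W : Ω → ℝ) (w : ℝ → ℝ) : Prop :=
  Measurable w ∧ P[W | MeasurableSpace.comap q inferInstance] =ᵐ[P] fun ω => w (q ω)

/-- `Var(X_{i2} | Q_i = τ)`, read off `D(τ) = E(X_i X_i' | Q_i = τ)`, whose first row and column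
hold the conditional means because the first regressor is `1`. -/
def condVar (D : ℝ → Matrix (RegIdx p) (RegIdx p) ℝ) (τ : ℝ) : Matrix (Fin p) (Fin p) ℝ :=
  Matrix.of fun a b => D τ (iMid a) (iMid b) - D τ (iMid a) iOne * D τ iOne (iMid b)

/-- Regularity of the density of `Q_i` and of the conditional moments given `Q_i = τ`.  As always
these functions are determined up to null sets, so the assumption is that versions exist:
`f` the density, `D(τ) = E(X_i X_i' | Q_i = τ)`, `V(τ) = E(X_i X_i' U_i² | Q_i = τ)`,
`g(τ) = E(|X_i|⁴ | Q_i = τ)` and `h(τ) = E(|X_i U_i|⁴ | Q_i = τ)`. -/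
def RegularityAssumption (P : Measure Ω) (X₂ : ℤ → Ω → Fin p → ℝ) (Q U : ℤ → Ω → ℝ)
    (T : Set ℝ) (τ₀ : ℝ) : Prop :=
  ∃ (f : ℝ → ℝ) (D V : ℝ → Matrix (RegIdx p) (RegIdx p) ℝ) (g h : ℝ → ℝ),
    IsDensity P (Q 0) f ∧
    (∀ a b, IsCondMean P (Q 0) (fun ω => X X₂ Q 0 ω a * X X₂ Q 0 ω b) (fun τ => D τ a b)) ∧
    (∀ a b, IsCondMean P (Q 0) (fun ω => X X₂ Q 0 ω a * X X₂ Q 0 ω b * U 0 ω ^ 2)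
      (fun τ => V τ a b)) ∧
    IsCondMean P (Q 0) (fun ω => ‖WithLp.toLp 2 (X X₂ Q 0 ω)‖ ^ 4) g ∧
    IsCondMean P (Q 0) (fun ω => ‖WithLp.toLp 2 (U 0 ω • X X₂ Q 0 ω)‖ ^ 4) h ∧
    (ContinuousAt f τ₀ ∧ ContinuousAt V τ₀ ∧ ContinuousAt D τ₀) ∧
    (ContinuousOn f T ∧ ∀ τ ∈ T, 0 < f τ) ∧
    (ContinuousOn (lowerMoment P X₂ Q) T ∧ ∀ τ ∈ T, (lowerMoment P X₂ Q τ).PosDef) ∧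
    (ContinuousOn (condVar D) T ∧ ∀ τ ∈ T, (condVar D τ).PosDef) ∧
    ∃ C : ℝ, ∀ τ ∈ T, f τ ≤ C ∧ g τ ≤ C ∧ h τ ≤ C

/-! ### Estimators and test statistic -/

/-- The least squares criterion `S_n(θ) = n⁻¹ ∑_{i=1}^n (Y_i - X_i(τ)'α)²`. -/
def criterion (θ₀ : Param p) (X₂ : ℤ → Ω → Fin p → ℝ) (Q U : ℤ → Ω → ℝ) (n : ℕ) (ω : Ω)
    (θ : Param p) : ℝ :=
  (1 / (n : ℝ)) * ∑ i ∈ Finset.range n,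
    (Y θ₀ X₂ Q U ((i : ℤ) + 1) ω - regFun θ (X₂ ((i : ℤ) + 1) ω) (Q ((i : ℤ) + 1) ω)) ^ 2

/-- `θ` is a minimizer of `S` over the set `K`. -/
def IsArgmin (S : Param p → ℝ) (K : Set (Param p)) (θ : Param p) : Prop :=
  θ ∈ K ∧ ∀ θ' ∈ K, S θ ≤ S θ'

/-- The quasi-likelihood ratio statistic `T_n = n (S_n(θ̃) - S_n(θ̂)) / S_n(θ̂)`. -/
def testStat (θ₀ : Param p) (X₂ : ℤ → Ω → Fin p → ℝ) (Q U : ℤ → Ω → ℝ)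
    (θhat θtilde : ℕ → Ω → Param p) (n : ℕ) (ω : Ω) : ℝ :=
  n * (criterion θ₀ X₂ Q U n ω (θtilde n ω) - criterion θ₀ X₂ Q U n ω (θhat n ω)) /
    criterion θ₀ X₂ Q U n ω (θhat n ω)

end Model

end ThresholdRegression

end

/-! ### Covariances and maximal correlation. -/

namespace ThresholdRegression

/-! Write `d` for the true regression function minus that of a candidate `θ`. The criterion at `θ`
exceeds its value at the truth by the sample mean of `d² + 2Ud`. Errors are orthogonal to functions
of current regressors, so this excess has expectation `E d²`. Three facts then give the theorem.

Identification (`not_ae_fit_eq`): no kink parameter reproduces a jump regression function almost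
surely, so `E d² > 0` at every kink parameter.

Uniformity (`exists_uniform_lower_bound`): kink regression functions are continuous in the regressor
and Lipschitz in `θ`. A weak law from ρ-mixing and Chebyshev, together with compactness, turns
pointwise positivity into one `ε > 0` below which the excess falls only with vanishing probability
(`exists_excess_lower_bound`). The numerator of the statistic is therefore at least `nε`, since the
unrestricted minimum is at most the criterion at the truth.

Denominator: that same comparison bounds it above by the mean of `U²`. It must also be nonzero, and
here Lipschitz continuity in the threshold is unavailable. But wherever the fitted threshold lies,
on at least one side of `τ₀` the difference `d` is linear in the regressor, and one-sided linear
regressions have residuals bounded away from zero (`exists_residual_lower_bound`,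
`residual_le_criterion`). -/

/-- Cauchy–Schwarz by the discriminant: the variance of `f + t g` is a nonnegative quadratic in `t`.
-/
theorem abs_covariance_le {Ω : Type*} [MeasurableSpace Ω] {P : Measure Ω} [IsProbabilityMeasure P]
    {f g : Ω → ℝ} (hf : MemLp f 2 P) (hg : MemLp g 2 P) :
    |covariance f g P| ≤ √(variance f P) * √(variance g P) := by
  have h : ∀ t : ℝ, 0 ≤ variance g P * (t * t) + 2 * covariance f g P * t + variance f P := by
    intro t
    have h0 := variance_nonneg (f + t • g) P
    rw [variance_add hf (hg.const_smul t), covariance_smul_right, variance_smul] at h0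
    linarith
  have hd := discrim_le_zero h
  rw [discrim] at hd
  rw [← Real.sqrt_mul (variance_nonneg f P)]
  apply Real.abs_le_sqrt
  linarith

/-- Boundedness makes the real supremum in `maxCorr` genuine rather than the default value `0`. -/
theorem maxCorr_set_le_one {Ω : Type*} (A B : MeasurableSpace Ω) [MeasurableSpace Ω] (P : Measure Ω)
    [IsProbabilityMeasure P] :
    ∀ r ∈ {r : ℝ | ∃ f g : Ω → ℝ, Measurable[A] f ∧ Measurable[B] g ∧ MemLp f 2 P ∧ MemLp g 2 P ∧
      r = |covariance f g P| / (√(variance f P) * √(variance g P))}, r ≤ 1 := by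
  rintro r ⟨f, g, -, -, hf, hg, rfl⟩
  exact div_le_one_of_le₀ (abs_covariance_le hf hg) (by positivity)

theorem maxCorr_nonneg {Ω : Type*} (A B : MeasurableSpace Ω) [MeasurableSpace Ω] (P : Measure Ω) :
    0 ≤ maxCorr P A B := by
  apply Real.sSup_nonneg
  rintro r ⟨f, g, -, -, -, -, rfl⟩
  positivity

theorem maxCorr_le_one {Ω : Type*} (A B : MeasurableSpace Ω) [MeasurableSpace Ω] (P : Measure Ω)
    [IsProbabilityMeasure P] : maxCorr P A B ≤ 1 :=
  Real.sSup_le (maxCorr_set_le_one A B P) zero_le_one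

theorem abs_covariance_le_maxCorr {Ω : Type*} {A B : MeasurableSpace Ω} [MeasurableSpace Ω]
    {P : Measure Ω} [IsProbabilityMeasure P] {f g : Ω → ℝ} (hfA : Measurable[A] f)
    (hgB : Measurable[B] g) (hf : MemLp f 2 P) (hg : MemLp g 2 P) :
    |covariance f g P| ≤ maxCorr P A B * (√(variance f P) * √(variance g P)) := by
  have h1 : |covariance f g P| / (√(variance f P) * √(variance g P)) ≤ maxCorr P A B :=
    le_csSup ⟨1, maxCorr_set_le_one A B P⟩ ⟨f, g, hfA, hgB, hf, hg, rfl⟩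
  have h2 := abs_covariance_le hf hg
  -- If a variance vanishes, the correlation is the default `0` and carries no information;
  -- Cauchy–Schwarz then gives zero covariance directly.
  rcases (show 0 ≤ √(variance f P) * √(variance g P) by positivity).eq_or_lt with h0 | h0
  · rw [← h0] at h2 ⊢
    simpa using h2
  · exact (div_le_iff₀ h0).1 h1

/-! ### Weak law of large numbers under ρ-mixing. -/

section Mixing

variable {Ω E : Type*} [MeasurableSpace Ω] [mE : MeasurableSpace E] {P : Measure Ω}
  {Z : ℤ → Ω → E}

theorem IsStationaryErgodic.identDistrib (h : IsStationaryErgodic P Z)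
    (hZ : ∀ i, Measurable (Z i)) (i : ℕ) : IdentDistrib (Z i) (Z 0) P P := by
  refine ⟨(hZ _).aemeasurable, (hZ _).aemeasurable, ?_⟩
  have hm : Measurable fun ω (i : ℤ) => Z i ω := measurable_pi_lambda _ hZ
  induction i with
  | zero => rfl
  | succ k ih =>
    rw [← ih]
    have h1 := h.toMeasurePreserving.map_eq
    have h2 := congrArg (Measure.map fun z : ℤ → E => z k) h1
    rw [Measure.map_map (measurable_pi_apply _) h.measurable, Measure.map_map _ hm,
      Measure.map_map (measurable_pi_apply _) hm] at h2
    · simpa [Function.comp_def] using h2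
    · exact (measurable_pi_apply _).comp h.measurable

theorem rhoMixing_nonneg (P : Measure Ω) (Z : ℤ → Ω → E) (m : ℕ) : 0 ≤ rhoMixing P Z m :=
  Real.iSup_nonneg fun _ => maxCorr_nonneg _ _ P

theorem rhoMixing_le_one (P : Measure Ω) [IsProbabilityMeasure P] (Z : ℤ → Ω → E) (m : ℕ) :
    rhoMixing P Z m ≤ 1 :=
  Real.iSup_le (fun _ => maxCorr_le_one _ _ P) zero_le_one

theorem maxCorr_le_rhoMixing (P : Measure Ω) [IsProbabilityMeasure P] (Z : ℤ → Ω → E) (m : ℕ)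
    (k : ℤ) :
    maxCorr P (⨆ j : Set.Iic k, mE.comap (Z j)) (⨆ j : Set.Ici (k + m), mE.comap (Z j)) ≤
      rhoMixing P Z m :=
  le_ciSup (f := fun k : ℤ => maxCorr P (⨆ j : Set.Iic k, mE.comap (Z j))
    (⨆ j : Set.Ici (k + m), mE.comap (Z j)))
    ⟨1, by rintro _ ⟨k, rfl⟩; exact maxCorr_le_one _ _ P⟩ k

/-- Coefficients lie in `[0, 1]`, so each is at most its square root. -/
theorem summable_rhoMixing (P : Measure Ω) [IsProbabilityMeasure P] (Z : ℤ → Ω → E)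
    (h : Summable fun m : ℕ => √(rhoMixing P Z (m + 1))) : Summable (rhoMixing P Z) := by
  rw [← summable_nat_add_iff 1]
  refine Summable.of_nonneg_of_le (fun m => rhoMixing_nonneg P Z _) (fun m => ?_) h
  exact Real.le_sqrt_of_sq_le
    (by nlinarith [rhoMixing_nonneg P Z (m + 1), rhoMixing_le_one P Z (m + 1)])

variable [IsProbabilityMeasure P]

theorem abs_covariance_le_rhoMixing (hst : IsStationaryErgodic P Z) (hZ : ∀ i, Measurable (Z i))
    {φ : E → ℝ} (hφ : Measurable φ) (h2 : MemLp (fun ω => φ (Z 0 ω)) 2 P) (i m : ℕ) :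
    |covariance (fun ω => φ (Z i ω)) (fun ω => φ (Z (i + m : ℕ) ω)) P| ≤
      rhoMixing P Z m * variance (fun ω => φ (Z 0 ω)) P := by
  have hid : ∀ k : ℕ, IdentDistrib (fun ω => φ (Z k ω)) (fun ω => φ (Z 0 ω)) P P := fun k =>
    (hst.identDistrib hZ k).comp hφ
  have hf : Measurable[⨆ j : Set.Iic (i : ℤ), mE.comap (Z j)] fun ω => φ (Z i ω) :=
    hφ.comp (Measurable.of_comap_le
      (le_iSup (fun j : Set.Iic (i : ℤ) => mE.comap (Z j)) ⟨i, Set.self_mem_Iic⟩))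
  have hg : Measurable[⨆ j : Set.Ici ((i : ℤ) + m), mE.comap (Z j)]
      fun ω => φ (Z (i + m : ℕ) ω) :=
    hφ.comp (Measurable.of_comap_le
      (le_iSup (fun j : Set.Ici ((i : ℤ) + m) => mE.comap (Z j)) ⟨(i + m : ℕ), by simp⟩))
  have h := abs_covariance_le_maxCorr hf hg ((hid i).symm.memLp_snd h2)
    ((hid (i + m)).symm.memLp_snd h2)
  rw [(hid i).variance_eq, (hid (i + m)).variance_eq,
    Real.mul_self_sqrt (variance_nonneg _ _)] at h
  exact h.trans (mul_le_mul_of_nonneg_right (maxCorr_le_rhoMixing P Z m i) (variance_nonneg _ _))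

/-- The covariance of two terms decays with their lag at the summable rate `ρ`, so each row of the
covariance matrix has bounded sum and the variance grows only linearly in `n`. -/
theorem variance_sum_le_of_mixing (hst : IsStationaryErgodic P Z) (hZ : ∀ i, Measurable (Z i))
    (hmix : Summable fun m : ℕ => √(rhoMixing P Z (m + 1)))
    {φ : E → ℝ} (hφ : Measurable φ) (h2 : MemLp (fun ω => φ (Z 0 ω)) 2 P) (n : ℕ) :
    variance (fun ω => ∑ i ∈ Finset.range n, φ (Z ((i : ℤ) + 1) ω)) P ≤
      n * (2 * ((∑' m, rhoMixing P Z m) * variance (fun ω => φ (Z 0 ω)) P)) := by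
  have hid : ∀ k : ℕ, IdentDistrib (fun ω => φ (Z k ω)) (fun ω => φ (Z 0 ω)) P P := fun k =>
    (hst.identDistrib hZ k).comp hφ
  have hL : ∀ i : ℕ, MemLp (fun ω => φ (Z ((i : ℤ) + 1) ω)) 2 P := fun i => by
    exact_mod_cast (hid (i + 1)).symm.memLp_snd h2
  set v := variance (fun ω => φ (Z 0 ω)) P
  have hv : 0 ≤ v := variance_nonneg _ _
  have hs := summable_rhoMixing P Z hmix
  -- Splitting into upper and lower triangles counts the diagonal twice, which is harmless and gives
  -- two symmetric halves.
  have hbd : ∀ i j : ℕ, covariance (fun ω => φ (Z ((i : ℤ) + 1) ω))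
      (fun ω => φ (Z ((j : ℤ) + 1) ω)) P ≤
      (if i ≤ j then rhoMixing P Z (j - i) * v else 0) +
      (if j ≤ i then rhoMixing P Z (i - j) * v else 0) := by
    have key : ∀ i j : ℕ, i ≤ j → covariance (fun ω => φ (Z ((i : ℤ) + 1) ω))
      (fun ω => φ (Z ((j : ℤ) + 1) ω)) P ≤ rhoMixing P Z (j - i) * v := by
      intro i j hij
      obtain ⟨m, rfl⟩ := Nat.exists_eq_add_of_le hij
      have h := (le_abs_self _).trans (abs_covariance_le_rhoMixing hst hZ hφ h2 (i + 1) m)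
      rw [add_tsub_cancel_left]
      have e : (((i + m : ℕ) : ℤ) + 1) = ((i + 1 + m : ℕ) : ℤ) := by push_cast; ring
      rw [e]
      exact_mod_cast h
    have hn : ∀ m, 0 ≤ rhoMixing P Z m * v := fun m => mul_nonneg (rhoMixing_nonneg _ _ _) hv
    intro i j
    rcases le_total i j with h | h
    · rw [if_pos h]
      refine (key i j h).trans (le_add_of_nonneg_right ?_)
      split_ifs
      exacts [hn _, le_rfl]
    · rw [if_pos h, covariance_comm]
      refine (key j i h).trans (le_add_of_nonneg_left ?_)
      split_ifs
      exacts [hn _, le_rfl]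
  have hrow : ∀ i : ℕ, ∑ j ∈ Finset.range n, (if i ≤ j then rhoMixing P Z (j - i) * v else 0) ≤
      (∑' m, rhoMixing P Z m) * v := by
    intro i
    rw [← Finset.sum_filter, ← Finset.sum_mul]
    refine mul_le_mul_of_nonneg_right ?_ hv
    -- For fixed `i` the lags `j - i` with `j ≥ i` are distinct, so the row is a partial sum of the
    -- coefficient series.
    rw [← Finset.sum_image (g := fun j => j - i) (f := fun m => rhoMixing P Z m)]
    · exact hs.sum_le_tsum _ (fun m _ => rhoMixing_nonneg _ _ _)
    · intro a ha b hb hab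
      simp only [Finset.coe_filter, Set.mem_ofPred_eq] at ha hb hab
      omega
  rw [variance_fun_sum' (fun i _ => hL i)]
  calc _ ≤ ∑ i ∈ Finset.range n, ∑ j ∈ Finset.range n,
      ((if i ≤ j then rhoMixing P Z (j - i) * v else 0) +
      (if j ≤ i then rhoMixing P Z (i - j) * v else 0)) :=
        Finset.sum_le_sum fun i _ => Finset.sum_le_sum fun j _ => hbd i j
    _ = ∑ i ∈ Finset.range n, ∑ j ∈ Finset.range n,
          (if i ≤ j then rhoMixing P Z (j - i) * v else 0) +
        ∑ j ∈ Finset.range n, ∑ i ∈ Finset.range n,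
          (if j ≤ i then rhoMixing P Z (i - j) * v else 0) := by
        simp only [Finset.sum_add_distrib]
        congr 1
        exact Finset.sum_comm
    _ ≤ ∑ i ∈ Finset.range n, (∑' m, rhoMixing P Z m) * v +
        ∑ i ∈ Finset.range n, (∑' m, rhoMixing P Z m) * v :=
        add_le_add (Finset.sum_le_sum fun i _ => hrow i) (Finset.sum_le_sum fun i _ => hrow i)
    _ = _ := by simp; ring

/-- Sample average over the time points `1, …, n`. -/
noncomputable def sampleMean (Z : ℤ → Ω → E) (φ : E → ℝ) (n : ℕ) (ω : Ω) : ℝ :=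
  (1 / (n : ℝ)) * ∑ i ∈ Finset.range n, φ (Z ((i : ℤ) + 1) ω)

/-- Weak law of large numbers for `ρ`-mixing stationary processes. -/
theorem weak_law_of_mixing (hst : IsStationaryErgodic P Z) (hZ : ∀ i, Measurable (Z i))
    (hmix : Summable fun m : ℕ => √(rhoMixing P Z (m + 1)))
    {φ : E → ℝ} (hφ : Measurable φ) (h2 : MemLp (fun ω => φ (Z 0 ω)) 2 P) {ε : ℝ} (hε : 0 < ε) :
    Tendsto (fun n : ℕ => P {ω | ε ≤ |sampleMean Z φ n ω - ∫ ω, φ (Z 0 ω) ∂P|}) atTop (𝓝 0) := by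
  have hid : ∀ k : ℕ, IdentDistrib (fun ω => φ (Z k ω)) (fun ω => φ (Z 0 ω)) P P := fun k =>
    (hst.identDistrib hZ k).comp hφ
  have hL : ∀ i : ℕ, MemLp (fun ω => φ (Z ((i : ℤ) + 1) ω)) 2 P := fun i => by
    exact_mod_cast (hid (i + 1)).symm.memLp_snd h2
  have hI : ∀ i : ℕ, ∫ ω, φ (Z ((i : ℤ) + 1) ω) ∂P = ∫ ω, φ (Z 0 ω) ∂P := fun i => by
    exact_mod_cast (hid (i + 1)).integral_eq
  set c := 2 * ((∑' m, rhoMixing P Z m) * variance (fun ω => φ (Z 0 ω)) P)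
  have hlim : Tendsto (fun n : ℕ => ENNReal.ofReal (c / ε ^ 2 / n)) atTop (𝓝 0) := by
    rw [← ENNReal.ofReal_zero]
    exact ENNReal.tendsto_ofReal (tendsto_const_div_atTop_nhds_zero_nat _)
  refine tendsto_of_tendsto_of_tendsto_of_le_of_le' tendsto_const_nhds hlim
    (Eventually.of_forall fun _ => zero_le) ?_
  filter_upwards [eventually_gt_atTop 0] with n hn
  have hn' : (0 : ℝ) < n := by exact_mod_cast hn
  have hM : MemLp (sampleMean Z φ n) 2 P :=
    (memLp_finsetSum (Finset.range n) (fun i _ => hL i)).const_mul (1 / (n : ℝ))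
  have hE : P[sampleMean Z φ n] = ∫ ω, φ (Z 0 ω) ∂P := by
    unfold sampleMean
    rw [integral_const_mul, integral_finsetSum _ fun i _ => (hL i).integrable one_le_two]
    simp only [hI, Finset.sum_const, Finset.card_range, nsmul_eq_mul]
    field_simp
  have h := meas_ge_le_variance_div_sq hM hε
  rw [hE] at h
  refine h.trans (ENNReal.ofReal_le_ofReal ?_)
  rw [div_right_comm]
  refine div_le_div_of_nonneg_right ?_ (by positivity)
  unfold sampleMean
  rw [variance_const_mul, le_div_iff₀ hn']
  have hv := variance_sum_le_of_mixing hst hZ hmix hφ h2 n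
  calc _ ≤ (1 / (n : ℝ)) ^ 2 * (n * c) * n := by gcongr
    _ = c := by field_simp

end Mixing

/-! ### Uniform lower bounds over compact parameter sets. -/

/-- Over a compact parameter set, sample means of a Lipschitz family of functions with positive
expectations are bounded away from zero with probability tending to one. -/
theorem exists_uniform_lower_bound {Ω E A : Type*} [MeasurableSpace Ω] [MeasurableSpace E]
    [PseudoMetricSpace A] {P : Measure Ω} [IsProbabilityMeasure P] {Z : ℤ → Ω → E}
    (hst : IsStationaryErgodic P Z) (hZ : ∀ i, Measurable (Z i))
    (hmix : Summable fun m : ℕ => √(rhoMixing P Z (m + 1)))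
    {G : Set E} (hG : ∀ i ω, Z i ω ∈ G) {e : E → ℝ} (he : Measurable e)
    (he2 : MemLp (fun ω => e (Z 0 ω)) 2 P) {K : Set A} (hK : IsCompact K) {φ : A → E → ℝ}
    (hφ : ∀ θ ∈ K, Measurable (φ θ)) (hφ2 : ∀ θ ∈ K, MemLp (fun ω => φ θ (Z 0 ω)) 2 P) {L : ℝ}
    (hL : ∀ θ ∈ K, ∀ θ' ∈ K, ∀ z ∈ G, φ θ z - φ θ' z ≤ L * dist θ θ' * e z)
    (he0 : ∀ z, 0 ≤ e z) (hpos : ∀ θ ∈ K, 0 < ∫ ω, φ θ (Z 0 ω) ∂P) :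
    ∃ ε : ℝ, 0 < ε ∧
      Tendsto (fun n : ℕ => P {ω | ∃ θ ∈ K, sampleMean Z (φ θ) n ω < ε}) atTop (𝓝 0) := by
  have hmono : ∀ {s t : ℕ → Set Ω}, (∀ n, s n ⊆ t n) → Tendsto (fun n => P (t n)) atTop (𝓝 0) →
      Tendsto (fun n => P (s n)) atTop (𝓝 0) := fun h ht =>
    tendsto_of_tendsto_of_tendsto_of_le_of_le tendsto_const_nhds ht (fun _ => zero_le)
      fun n => measure_mono (h n)
  have hunion : ∀ {s t : ℕ → Set Ω}, Tendsto (fun n => P (s n)) atTop (𝓝 0) →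
      Tendsto (fun n => P (t n)) atTop (𝓝 0) →
      Tendsto (fun n => P (s n ∪ t n)) atTop (𝓝 0) := fun hs ht =>
    tendsto_of_tendsto_of_tendsto_of_le_of_le tendsto_const_nhds (by simpa using hs.add ht)
      (fun _ => zero_le) fun n => measure_union_le _ _
  -- Compactness induction runs over arbitrary sets `s`, whereas the hypotheses hold only on `K`;
  -- hence the intersection.
  suffices h : ∃ ε : ℝ, 0 < ε ∧
      Tendsto (fun n : ℕ => P {ω | ∃ θ ∈ K ∩ K, sampleMean Z (φ θ) n ω < ε}) atTop (𝓝 0) by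
    simpa using h
  refine hK.induction_on (p := fun s => ∃ ε : ℝ, 0 < ε ∧
    Tendsto (fun n : ℕ => P {ω | ∃ θ ∈ s ∩ K, sampleMean Z (φ θ) n ω < ε}) atTop (𝓝 0))
    ⟨1, one_pos, by simp⟩ ?_ ?_ ?_
  · rintro s t hst ⟨ε, hε, h⟩
    refine ⟨ε, hε, hmono (fun n ω => ?_) h⟩
    rintro ⟨θ, hθ, h⟩
    exact ⟨θ, ⟨hst hθ.1, hθ.2⟩, h⟩
  · rintro s t ⟨ε, hε, h⟩ ⟨ε', hε', h'⟩
    refine ⟨min ε ε', lt_min hε hε', hmono (fun n ω => ?_) (hunion h h')⟩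
    rintro ⟨θ, ⟨hθ | hθ, hθK⟩, h⟩
    · exact Or.inl ⟨θ, ⟨hθ, hθK⟩, h.trans_le (min_le_left _ _)⟩
    · exact Or.inr ⟨θ, ⟨hθ, hθK⟩, h.trans_le (min_le_right _ _)⟩
  · intro x hx
    set F := ∫ ω, φ x (Z 0 ω) ∂P with hF
    have hF0 : 0 < F := hpos x hx
    set M := ∫ ω, e (Z 0 ω) ∂P + 1
    have hM : 0 < M := by
      have : 0 ≤ ∫ ω, e (Z 0 ω) ∂P := integral_nonneg fun ω => he0 _
      positivity
    -- The radius makes the Lipschitz error at most `F / 4` once the mean of `e` is below `M`. The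
    -- weak law at `x` costs another `F / 4`, leaving `F / 2`. Using `|L| + 1` keeps the divisor
    -- positive.
    set r := F / (4 * (|L| + 1) * M)
    have hr : 0 < r := by positivity
    refine ⟨Metric.ball x r, mem_nhdsWithin_of_mem_nhds (Metric.ball_mem_nhds x hr), F / 2,
      by positivity, hmono (fun n ω => ?_) (hunion
        (weak_law_of_mixing hst hZ hmix (hφ x hx) (hφ2 x hx) (show 0 < F / 4 by positivity))
        (weak_law_of_mixing hst hZ hmix he he2 one_pos))⟩
    rintro ⟨θ, ⟨hθ, hθK⟩, h⟩
    by_contra hcon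
    simp only [Set.mem_union, Set.mem_ofPred_eq, not_or, not_le] at hcon
    obtain ⟨h1, h2⟩ := hcon
    have h1 := (abs_lt.1 h1).1
    have h2 := (abs_lt.1 h2).2
    have h3 : sampleMean Z (φ x) n ω - sampleMean Z (φ θ) n ω ≤
        L * dist x θ * sampleMean Z e n ω := by
      unfold sampleMean
      rw [← mul_sub, ← Finset.sum_sub_distrib, mul_left_comm]
      refine mul_le_mul_of_nonneg_left ?_ (by positivity)
      rw [Finset.mul_sum]
      exact Finset.sum_le_sum fun i _ => hL x hx θ hθK _ (hG _ _)
    have h4 : 0 ≤ sampleMean Z e n ω :=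
      mul_nonneg (by positivity) (Finset.sum_nonneg fun i _ => he0 _)
    have h5 : L * dist x θ * sampleMean Z e n ω ≤ (|L| + 1) * r * M := by
      have : dist x θ ≤ r := by rw [dist_comm]; exact hθ.le
      have : sampleMean Z e n ω ≤ M := by linarith
      have : L ≤ |L| + 1 := (le_abs_self L).trans (by linarith)
      gcongr
    have h6 : (|L| + 1) * r * M = F / 4 := by
      simp only [r]
      field_simp
    linarith

/-- A random vector with a positive definite second moment matrix is not degenerate. -/
theorem eq_zero_of_posDef_gram {Ω ι : Type*} [MeasurableSpace Ω] [Fintype ι] {μ : Measure Ω}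
    {w : ι → Ω → ℝ} {M : Matrix ι ι ℝ} (hM : M.PosDef) (hMw : ∀ a b, M a b = ∫ ω, w a ω * w b ω ∂μ)
    (hint : ∀ a b, Integrable (fun ω => w a ω * w b ω) μ) {v : ι → ℝ}
    (hv : ∀ᵐ ω ∂μ, ∑ a, w a ω * v a = 0) : v = 0 := by
  by_contra hne
  have h := hM.dotProduct_mulVec_pos hne
  -- Entry `a` is the integral of `w a` times the vanishing combination.
  have h0 : M *ᵥ v = 0 := by
    ext a
    simp only [Matrix.mulVec, dotProduct, hMw, Pi.zero_apply, ← integral_mul_const]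
    rw [← integral_finsetSum _ fun b _ => (hint a b).mul_const _]
    refine integral_eq_zero_of_ae ?_
    filter_upwards [hv] with ω hω
    simp only [mul_assoc, ← Finset.mul_sum, hω, mul_zero, Pi.zero_apply]
  rw [h0] at h
  simp at h

/-! ### Passing from almost sure statements to points of the density. -/

section Density

variable {Ω : Type*} [MeasurableSpace Ω] {P : Measure Ω} {q : Ω → ℝ} {f : ℝ → ℝ}

theorem IsDensity.ae_of_ae (hf : IsDensity P q f) (hq : Measurable q) {w : ℝ → Prop}
    (hw : MeasurableSet {t | w t}) (h : ∀ᵐ ω ∂P, w (q ω)) : ∀ᵐ t, 0 < f t → w t := by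
  have h1 : ∀ᵐ t ∂(P.map q), w t := (ae_map_iff hq.aemeasurable hw).2 h
  rw [hf.2.2, ae_withDensity_iff hf.1.ennreal_ofReal] at h1
  filter_upwards [h1] with t ht h0
  exact ht (by simpa using h0)

/-- Positivity and continuity of the density at `t₀` rule out failure of `w` throughout a
neighbourhood: its overlap with the interval would be open, nonempty and null. The point `t₀` may be
an endpoint, which is how it is used for `τ₀`. -/
theorem IsDensity.frequently_of_ae (hf : IsDensity P q f) (hq : Measurable q) {w : ℝ → Prop}
    (hw : MeasurableSet {t | w t}) {a b t₀ : ℝ} (hab : a < b) (ht₀ : t₀ ∈ Set.Icc a b)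
    (hcont : ContinuousAt f t₀) (hpos : 0 < f t₀)
    (h : ∀ᵐ ω ∂P, q ω ∈ Set.Ioo a b → w (q ω)) : ∃ᶠ t in 𝓝 t₀, w t := by
  have hae := hf.ae_of_ae hq (w := fun t => t ∈ Set.Ioo a b → w t)
    (by
      convert measurableSet_Ioo.compl.union hw using 1
      ext t
      exact imp_iff_not_or) h
  intro hn
  obtain ⟨O, hO, hOo, htO⟩ := eventually_nhds_iff.1 (hn.and (hcont.eventually (lt_mem_nhds hpos)))
  rw [← closure_Ioo hab.ne] at ht₀
  have hne : (O ∩ Set.Ioo a b).Nonempty := mem_closure_iff.1 ht₀ O hOo htO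
  have hm : (volume (O ∩ Set.Ioo a b)) ≠ 0 := ((hOo.inter isOpen_Ioo).measure_pos _ hne).ne'
  refine hm (measure_mono_null (fun t ht => ?_) hae)
  exact fun h => (hO t ht.1).1 (h (hO t ht.1).2 ht.2)

end Density

/-! ### The regression function and its envelope. -/

section Regression

variable {p : ℕ}

/-- The regression function `x'β + x'δ 1{q > τ}` in terms of the regressor `x = (1, x₂, q)`. -/
noncomputable def fit (θ : Param p) (x : RegIdx p → ℝ) : ℝ :=
  x ⬝ᵥ (θ.1 ∘ Sum.inl) + if θ.2 < x iThr then x ⬝ᵥ (θ.1 ∘ Sum.inr) else 0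

theorem regFun_eq_fit (θ : Param p) (x₂ : Fin p → ℝ) (q : ℝ) :
    regFun θ x₂ q = fit θ (regressor x₂ q) := by
  unfold regFun fit regressorAt
  rw [dotProduct, Fintype.sum_sum_type]
  congr 1
  have h : regressor x₂ q iThr = q := rfl
  rw [h]
  split_ifs <;> simp [dotProduct, *]

theorem measurable_dotProduct_const (b : RegIdx p → ℝ) :
    Measurable fun x : RegIdx p → ℝ => x ⬝ᵥ b := by
  unfold dotProduct
  fun_prop

theorem measurable_fit (θ : Param p) : Measurable (fit θ) := by
  unfold fit
  refine (measurable_dotProduct_const _).add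
    (Measurable.ite ?_ (measurable_dotProduct_const _) measurable_const)
  exact measurableSet_lt measurable_const (measurable_pi_apply _)

theorem abs_dotProduct_le (x b : RegIdx p → ℝ) :
    |x ⬝ᵥ b| ≤ Fintype.card (RegIdx p) * (‖x‖ * ‖b‖) := by
  unfold dotProduct
  refine (Finset.abs_sum_le_sum_abs _ _).trans ?_
  rw [← nsmul_eq_mul]
  refine Finset.sum_le_card_nsmul _ _ _ fun i _ => ?_
  rw [abs_mul]
  exact mul_le_mul (norm_le_pi_norm x i) (norm_le_pi_norm b i) (abs_nonneg _) (norm_nonneg _)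

theorem norm_comp_inl_le (α : Slope p) : ‖α ∘ Sum.inl‖ ≤ ‖α‖ :=
  (pi_norm_le_iff_of_nonneg (norm_nonneg _)).2 fun _ => norm_le_pi_norm α _

theorem norm_comp_inr_le (α : Slope p) : ‖α ∘ Sum.inr‖ ≤ ‖α‖ :=
  (pi_norm_le_iff_of_nonneg (norm_nonneg _)).2 fun _ => norm_le_pi_norm α _

theorem abs_fit_le (θ : Param p) (x : RegIdx p → ℝ) :
    |fit θ x| ≤ 2 * Fintype.card (RegIdx p) * ‖θ.1‖ * ‖x‖ := by
  have h1 : |x ⬝ᵥ (θ.1 ∘ Sum.inl)| ≤ Fintype.card (RegIdx p) * (‖x‖ * ‖θ.1‖) :=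
    (abs_dotProduct_le x _).trans (by gcongr; exact norm_comp_inl_le _)
  have h2 : |if θ.2 < x iThr then x ⬝ᵥ (θ.1 ∘ Sum.inr) else 0| ≤
      Fintype.card (RegIdx p) * (‖x‖ * ‖θ.1‖) := by
    split_ifs
    · exact (abs_dotProduct_le x _).trans (by gcongr; exact norm_comp_inr_le _)
    · rw [abs_zero]; positivity
  exact (abs_add_le _ _).trans (by linarith)

theorem IsKink.dotProduct_eq {θ : Param p} (h : IsKink θ) {x : RegIdx p → ℝ} (hx : x iOne = 1) :
    x ⬝ᵥ (θ.1 ∘ Sum.inr) = θ.1 (Sum.inr iThr) * (x iThr - θ.2) := by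
  have h1 := h.1
  simp only [dotProduct, Fintype.sum_sum_type, Function.comp_apply, Finset.univ_unique,
    Finset.sum_singleton, h.2, mul_zero, Finset.sum_const_zero, zero_add]
  change x iOne * θ.1 (Sum.inr iOne) + x iThr * θ.1 (Sum.inr iThr) = _
  rw [hx]
  linarith

/-- The restriction turns the discontinuous indicator term into a hinge, continuous in both the
regressor and the threshold. -/
theorem IsKink.fit_eq {θ : Param p} (h : IsKink θ) {x : RegIdx p → ℝ} (hx : x iOne = 1) :
    fit θ x = x ⬝ᵥ (θ.1 ∘ Sum.inl) + θ.1 (Sum.inr iThr) * max (x iThr - θ.2) 0 := by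
  unfold fit
  rw [h.dotProduct_eq hx]
  split_ifs with hlt
  · rw [max_eq_left (by linarith)]
  · rw [max_eq_right (by linarith), mul_zero]

theorem isClosed_setOf_isKink : IsClosed {θ : Param p | IsKink θ} := by
  have : {θ : Param p | IsKink θ} =
      {θ | θ.1 (Sum.inr iOne) + θ.1 (Sum.inr iThr) * θ.2 = 0} ∩
        ⋂ j : Fin p, {θ | θ.1 (Sum.inr (iMid j)) = 0} := by
    ext θ
    simp [IsKink]
  rw [this]
  refine (isClosed_eq (by fun_prop) (by fun_prop)).inter
    (isClosed_iInter fun j => isClosed_eq (by fun_prop) (by fun_prop))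

theorem one_le_norm {x : RegIdx p → ℝ} (hx : x iOne = 1) : 1 ≤ ‖x‖ := by
  simpa [hx] using norm_le_pi_norm x iOne

/-- The hinge is 1-Lipschitz in the threshold. Constants are absorbed into `‖x‖`, which is at least
`1` because of the intercept. -/
theorem IsKink.abs_fit_sub_le {θ θ' : Param p} (h : IsKink θ) (h' : IsKink θ') {R : ℝ}
    (hθ : ‖θ‖ ≤ R) (hθ' : ‖θ'‖ ≤ R) {x : RegIdx p → ℝ} (hx : x iOne = 1) :
    |fit θ x - fit θ' x| ≤ (Fintype.card (RegIdx p) + 1 + 2 * R) * dist θ θ' * ‖x‖ := by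
  rw [h.fit_eq hx, h'.fit_eq hx]
  have hR : 0 ≤ R := (norm_nonneg _).trans hθ
  have hx1 := one_le_norm hx
  set D := dist θ θ'
  have hD : 0 ≤ D := dist_nonneg
  have hD1 : ‖θ.1 - θ'.1‖ ≤ D := by
    rw [← dist_eq_norm]; exact le_max_left _ _
  have hD2 : |θ.2 - θ'.2| ≤ D := le_max_right (dist θ.1 θ'.1) _
  have h1 : |x ⬝ᵥ (θ.1 ∘ Sum.inl) - x ⬝ᵥ (θ'.1 ∘ Sum.inl)| ≤
      Fintype.card (RegIdx p) * (‖x‖ * D) := by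
    rw [← dotProduct_sub]
    refine (abs_dotProduct_le x _).trans ?_
    gcongr
    exact (norm_comp_inl_le (θ.1 - θ'.1)).trans hD1
  have h2 : |θ.1 (Sum.inr iThr) - θ'.1 (Sum.inr iThr)| ≤ D :=
    (norm_le_pi_norm (θ.1 - θ'.1) (Sum.inr iThr)).trans hD1
  have h3 : |θ'.1 (Sum.inr iThr)| ≤ R :=
    (norm_le_pi_norm θ'.1 (Sum.inr iThr)).trans ((norm_fst_le θ').trans hθ')
  have h4 : |max (x iThr - θ.2) 0| ≤ ‖x‖ * (1 + R) := by
    have a1 : |x iThr| ≤ ‖x‖ := norm_le_pi_norm x iThr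
    have a2 : |θ.2| ≤ R := (norm_snd_le θ).trans hθ
    have a3 := (abs_le.1 a1).2
    have a4 := (abs_le.1 a2).1
    rw [abs_of_nonneg (le_max_right _ _)]
    refine max_le ?_ (by positivity)
    nlinarith
  have h5 : |max (x iThr - θ.2) 0 - max (x iThr - θ'.2) 0| ≤ D := by
    refine (abs_max_sub_max_le_abs _ _ _).trans ?_
    rw [show x iThr - θ.2 - (x iThr - θ'.2) = -(θ.2 - θ'.2) by ring, abs_neg]
    exact hD2
  have h6 : |(θ.1 (Sum.inr iThr) - θ'.1 (Sum.inr iThr)) * max (x iThr - θ.2) 0| ≤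
      D * (‖x‖ * (1 + R)) := by
    rw [abs_mul]; gcongr
  have h7 : |θ'.1 (Sum.inr iThr) * (max (x iThr - θ.2) 0 - max (x iThr - θ'.2) 0)| ≤
      R * D * ‖x‖ := by
    rw [abs_mul]
    calc _ ≤ R * D := by gcongr
      _ ≤ R * D * ‖x‖ := le_mul_of_one_le_right (by positivity) hx1
  have e : x ⬝ᵥ (θ.1 ∘ Sum.inl) + θ.1 (Sum.inr iThr) * max (x iThr - θ.2) 0 -
      (x ⬝ᵥ (θ'.1 ∘ Sum.inl) + θ'.1 (Sum.inr iThr) * max (x iThr - θ'.2) 0) =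
      (x ⬝ᵥ (θ.1 ∘ Sum.inl) - x ⬝ᵥ (θ'.1 ∘ Sum.inl)) +
      (θ.1 (Sum.inr iThr) - θ'.1 (Sum.inr iThr)) * max (x iThr - θ.2) 0 +
      θ'.1 (Sum.inr iThr) * (max (x iThr - θ.2) 0 - max (x iThr - θ'.2) 0) := by ring
  rw [e]
  refine (abs_add_three _ _ _).trans ?_
  linarith

/-- Envelope of the squared regression residuals. -/
noncomputable def envelope (z : (RegIdx p → ℝ) × ℝ) : ℝ := ‖z.1‖ ^ 2 * (1 + z.2 ^ 2)

theorem envelope_nonneg (z : (RegIdx p → ℝ) × ℝ) : 0 ≤ envelope z := by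
  unfold envelope
  positivity

theorem measurable_envelope : Measurable (envelope (p := p)) := by
  unfold envelope
  fun_prop

theorem sq_norm_le_envelope (z : (RegIdx p → ℝ) × ℝ) : ‖z.1‖ ^ 2 ≤ envelope z := by
  unfold envelope
  nlinarith [sq_nonneg (‖z.1‖), mul_nonneg (sq_nonneg ‖z.1‖) (sq_nonneg z.2)]

theorem sq_mul_le_envelope (z : (RegIdx p → ℝ) × ℝ) : (|z.2| * ‖z.1‖) ^ 2 ≤ envelope z := by
  unfold envelope
  rw [mul_pow, sq_abs]
  nlinarith [sq_nonneg (‖z.1‖)]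

theorem mul_norm_le_envelope {z : (RegIdx p → ℝ) × ℝ} (hz : z.1 iOne = 1) :
    |z.2| * ‖z.1‖ ≤ envelope z := by
  unfold envelope
  have h := one_le_norm hz
  have h1 : |z.2| ≤ 1 + z.2 ^ 2 := by
    rw [← sq_abs]; nlinarith [sq_nonneg (|z.2| - 1), abs_nonneg z.2]
  rw [mul_comm]
  gcongr
  exact le_self_pow₀ h two_ne_zero

theorem sq_le_envelope {z : (RegIdx p → ℝ) × ℝ} (hz : z.1 iOne = 1) : z.2 ^ 2 ≤ envelope z := by
  refine le_trans ?_ (sq_mul_le_envelope z)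
  rw [mul_pow, sq_abs]
  exact le_mul_of_one_le_right (sq_nonneg _) (one_le_pow₀ (one_le_norm hz))

/-- Lipschitz bound for the excess squared loss `(u + d)² - u²` of a fit that deviates by `d`. -/
theorem excess_sub_le {d d' u a R D : ℝ} (ha : 0 ≤ a) (hD : 0 ≤ D)
    (hd : |d| ≤ R * a) (hd' : |d'| ≤ R * a) (hdd : |d - d'| ≤ D * a) :
    (d ^ 2 + 2 * u * d) - (d' ^ 2 + 2 * u * d') ≤ D * (2 * R * a ^ 2 + 2 * (|u| * a)) := by
  have e : (d ^ 2 + 2 * u * d) - (d' ^ 2 + 2 * u * d') = (d - d') * (d + d' + 2 * u) := by ring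
  have h : |d + d' + 2 * u| ≤ 2 * R * a + 2 * |u| := by
    refine (abs_add_three _ _ _).trans ?_
    rw [abs_mul, abs_two]
    linarith
  rw [e]
  calc _ ≤ |d - d'| * |d + d' + 2 * u| := by rw [← abs_mul]; exact le_abs_self _
    _ ≤ (D * a) * (2 * R * a + 2 * |u|) := by gcongr
    _ = _ := by ring

end Regression

/-! ### Moments, orthogonality and nondegenerate errors. -/

theorem abs_regressorAt_le {p : ℕ} (x₂ : Fin p → ℝ) (q τ : ℝ) (a : RegIdx p ⊕ RegIdx p) :
    |regressorAt x₂ q τ a| ≤ ‖regressor x₂ q‖ := by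
  rcases a with a | a
  · exact norm_le_pi_norm (regressor x₂ q) a
  · simp only [regressorAt, Sum.elim_inr]
    split_ifs
    · exact norm_le_pi_norm (regressor x₂ q) a
    · simp

theorem norm_le_norm_toLp {p : ℕ} (x : RegIdx p → ℝ) : ‖x‖ ≤ ‖WithLp.toLp 2 x‖ :=
  (pi_norm_le_iff_of_nonneg (norm_nonneg _)).2 fun i => PiLp.norm_apply_le (WithLp.toLp 2 x) i

section Model

variable {Ω : Type*} [MeasurableSpace Ω] {P : Measure Ω} {p : ℕ}
  {X₂ : ℤ → Ω → Fin p → ℝ} {Q U : ℤ → Ω → ℝ}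

/-- The observations `(X_i, U_i)`. -/
def obs (X₂ : ℤ → Ω → Fin p → ℝ) (Q U : ℤ → Ω → ℝ) (i : ℤ) (ω : Ω) : (RegIdx p → ℝ) × ℝ :=
  (X X₂ Q i ω, U i ω)

theorem measurable_X (hX₂ : ∀ i, Measurable (X₂ i)) (hQ : ∀ i, Measurable (Q i)) (i : ℤ) :
    Measurable (X X₂ Q i) := by
  refine measurable_pi_lambda _ fun a => ?_
  rcases a with _ | j | _
  · exact measurable_const
  · exact (measurable_pi_apply j).comp (hX₂ i)
  · exact hQ i

theorem measurable_obs (hX₂ : ∀ i, Measurable (X₂ i)) (hQ : ∀ i, Measurable (Q i))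
    (hU : ∀ i, Measurable (U i)) (i : ℤ) : Measurable (obs X₂ Q U i) :=
  (measurable_X hX₂ hQ i).prodMk (hU i)

theorem measurable_regressorAt (hX₂ : ∀ i, Measurable (X₂ i)) (hQ : ∀ i, Measurable (Q i)) (τ : ℝ)
    (a : RegIdx p ⊕ RegIdx p) : Measurable fun ω => regressorAt (X₂ 0 ω) (Q 0 ω) τ a := by
  have h := measurable_X hX₂ hQ 0
  rcases a with a | a
  · exact (measurable_pi_apply a).comp h
  · exact Measurable.ite (measurableSet_lt measurable_const (hQ 0))
      ((measurable_pi_apply a).comp h) measurable_const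

/-- The squared envelope is `(‖x‖² + ‖ux‖²)²`, at most twice the sum of the two fourth powers
assumed integrable. -/
theorem memLp_envelope {τ₀ : ℝ} (hX₂ : ∀ i, Measurable (X₂ i)) (hQ : ∀ i, Measurable (Q i))
    (hU : ∀ i, Measurable (U i)) (hdep : DependenceAssumption P X₂ Q U τ₀) :
    MemLp (fun ω => envelope (obs X₂ Q U 0 ω)) 2 P := by
  have hm := measurable_envelope.comp (measurable_obs hX₂ hQ hU 0)
  refine (memLp_two_iff_integrable_sq hm.aestronglyMeasurable).2 ?_
  refine ((hdep.moment_X.const_mul 2).add (hdep.moment_XU.const_mul 2)).mono'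
    (hm.pow_const 2).aestronglyMeasurable (ae_of_all _ fun ω => ?_)
  have h1 : ‖X X₂ Q 0 ω‖ ^ 4 ≤ ‖WithLp.toLp 2 (X X₂ Q 0 ω)‖ ^ 4 := by
    gcongr; exact norm_le_norm_toLp _
  have h2 : (|U 0 ω| * ‖X X₂ Q 0 ω‖) ^ 4 ≤ ‖WithLp.toLp 2 (U 0 ω • X X₂ Q 0 ω)‖ ^ 4 := by
    rw [← Real.norm_eq_abs, ← norm_smul]
    gcongr; exact norm_le_norm_toLp _
  simp only [Function.comp_apply, Pi.add_apply, Real.norm_eq_abs, abs_pow, sq_abs, envelope, obs]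
  have e : (‖X X₂ Q 0 ω‖ ^ 2 * (1 + U 0 ω ^ 2)) ^ 2 =
      (‖X X₂ Q 0 ω‖ ^ 2 + (|U 0 ω| * ‖X X₂ Q 0 ω‖) ^ 2) ^ 2 := by
    rw [mul_pow |U 0 ω|, sq_abs]; ring
  rw [e]
  nlinarith [sq_nonneg (‖X X₂ Q 0 ω‖ ^ 2 - (|U 0 ω| * ‖X X₂ Q 0 ω‖) ^ 2)]

theorem memLp_of_le_envelope {τ₀ : ℝ} (hX₂ : ∀ i, Measurable (X₂ i)) (hQ : ∀ i, Measurable (Q i))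
    (hU : ∀ i, Measurable (U i)) (hdep : DependenceAssumption P X₂ Q U τ₀)
    {φ : (RegIdx p → ℝ) × ℝ → ℝ} (hφ : Measurable φ) {C : ℝ}
    (hC : ∀ z, z.1 iOne = 1 → |φ z| ≤ C * envelope z) :
    MemLp (fun ω => φ (obs X₂ Q U 0 ω)) 2 P := by
  refine (memLp_envelope hX₂ hQ hU hdep).of_le_mul (c := C)
    (hφ.comp (measurable_obs hX₂ hQ hU 0)).aestronglyMeasurable (ae_of_all _ fun ω => ?_)
  rw [Real.norm_eq_abs, Real.norm_of_nonneg (envelope_nonneg _)]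
  exact hC _ rfl

variable [IsProbabilityMeasure P]

theorem integrable_of_le_envelope {τ₀ : ℝ} (hX₂ : ∀ i, Measurable (X₂ i))
    (hQ : ∀ i, Measurable (Q i))
    (hU : ∀ i, Measurable (U i)) (hdep : DependenceAssumption P X₂ Q U τ₀)
    {φ : (RegIdx p → ℝ) × ℝ → ℝ} (hφ : Measurable φ) {C : ℝ}
    (hC : ∀ z, z.1 iOne = 1 → |φ z| ≤ C * envelope z) :
    Integrable (fun ω => φ (obs X₂ Q U 0 ω)) P :=
  (memLp_of_le_envelope hX₂ hQ hU hdep hφ hC).integrable one_le_two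

/-- Errors are orthogonal to functions of the contemporaneous regressors. -/
theorem integral_mul_error_eq_zero {τ₀ : ℝ} (hX₂ : ∀ i, Measurable (X₂ i))
    (hQ : ∀ i, Measurable (Q i))
    (hU : ∀ i, Measurable (U i)) (hdep : DependenceAssumption P X₂ Q U τ₀)
    {ψ : (RegIdx p → ℝ) → ℝ} (hψ : Measurable ψ) {C : ℝ} (hC : ∀ x, |ψ x| ≤ C * ‖x‖) :
    Integrable (fun ω => ψ (X X₂ Q 0 ω) * U 0 ω) P ∧ ∫ ω, ψ (X X₂ Q 0 ω) * U 0 ω ∂P = 0 := by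
  have hC0 : ∀ x : RegIdx p → ℝ, x iOne = 1 → 0 ≤ C := fun x hx => by
    have := (abs_nonneg _).trans (hC x)
    exact nonneg_of_mul_nonneg_left this (one_pos.trans_le (one_le_norm hx))
  have hint : Integrable (fun ω => ψ (X X₂ Q 0 ω) * U 0 ω) P := by
    refine integrable_of_le_envelope hX₂ hQ hU hdep (φ := fun z => ψ z.1 * z.2) (C := C)
      ((hψ.comp measurable_fst).mul measurable_snd) fun z hz => ?_
    rw [abs_mul]
    calc _ ≤ C * ‖z.1‖ * |z.2| := by gcongr; exact hC _
      _ = C * (|z.2| * ‖z.1‖) := by ring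
      _ ≤ _ := mul_le_mul_of_nonneg_left (mul_norm_le_envelope hz) (hC0 _ hz)
  have hintU : Integrable (U 0) P := by
    refine integrable_of_le_envelope hX₂ hQ hU hdep (φ := fun z => z.2) (C := 1)
      measurable_snd fun z hz => ?_
    rw [one_mul]
    exact (le_mul_of_one_le_right (abs_nonneg _) (one_le_norm hz)).trans (mul_norm_le_envelope hz)
  refine ⟨hint, ?_⟩
  have hle : history X₂ Q U (0 - 1) ≤ ‹MeasurableSpace Ω› :=
    iSup_le fun j => sup_le (measurable_X hX₂ hQ _).comap_le (hU _).comap_le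
  -- The history at time `-1` already contains the regressor at time `0`, through the index `j =
  -- -1`.
  have hXm : Measurable[history X₂ Q U (0 - 1)] (X X₂ Q 0) := by
    refine Measurable.of_comap_le (le_trans ?_ (le_iSup _ (⟨-1, by simp⟩ : Set.Iic (0 - 1 : ℤ))))
    exact le_sup_left
  have h := condExp_mul_of_stronglyMeasurable_left (m := history X₂ Q U (0 - 1)) (μ := P)
    (f := fun ω => ψ (X X₂ Q 0 ω)) (g := U 0) (hψ.comp hXm).stronglyMeasurable hint hintU
  rw [← integral_condExp hle]
  refine integral_eq_zero_of_ae ?_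
  filter_upwards [h, hdep.martingale_difference 0] with ω h1 h2
  refine h1.trans ?_
  rw [Pi.mul_apply, h2, Pi.zero_apply, mul_zero]

theorem integrable_mul_X {τ₀ : ℝ} (hX₂ : ∀ i, Measurable (X₂ i)) (hQ : ∀ i, Measurable (Q i))
    (hU : ∀ i, Measurable (U i)) (hdep : DependenceAssumption P X₂ Q U τ₀) (a b : RegIdx p) :
    Integrable (fun ω => X X₂ Q 0 ω a * X X₂ Q 0 ω b) P := by
  refine integrable_of_le_envelope hX₂ hQ hU hdep (φ := fun z => z.1 a * z.1 b) (C := 1)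
    (by fun_prop) fun z _ => ?_
  rw [one_mul, abs_mul]
  refine le_trans ?_ (sq_norm_le_envelope z)
  rw [sq]
  exact mul_le_mul (norm_le_pi_norm z.1 a) (norm_le_pi_norm z.1 b) (abs_nonneg _) (norm_nonneg _)

theorem eq_zero_of_regressorAt {τ₀ : ℝ} (hX₂ : ∀ i, Measurable (X₂ i))
    (hQ : ∀ i, Measurable (Q i))
    (hU : ∀ i, Measurable (U i)) (hdep : DependenceAssumption P X₂ Q U τ₀)
    {v : RegIdx p ⊕ RegIdx p → ℝ}
    (hv : ∀ᵐ ω ∂P, ∑ a, regressorAt (X₂ 0 ω) (Q 0 ω) τ₀ a * v a = 0) : v = 0 := by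
  refine eq_zero_of_posDef_gram hdep.posDef_M (fun a b => rfl) (fun a b => ?_) hv
  refine ((memLp_envelope hX₂ hQ hU hdep).integrable one_le_two).mono'
    ((measurable_regressorAt hX₂ hQ τ₀ a).mul
      (measurable_regressorAt hX₂ hQ τ₀ b)).aestronglyMeasurable (ae_of_all _ fun ω => ?_)
  rw [norm_mul]
  refine le_trans ?_ (sq_norm_le_envelope _)
  rw [sq]
  exact mul_le_mul (abs_regressorAt_le _ _ _ _) (abs_regressorAt_le _ _ _ _) (abs_nonneg _)
    (norm_nonneg _)

theorem eq_zero_of_regressorAt_mul_error {τ₀ : ℝ} (hX₂ : ∀ i, Measurable (X₂ i))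
    (hQ : ∀ i, Measurable (Q i))
    (hU : ∀ i, Measurable (U i)) (hdep : DependenceAssumption P X₂ Q U τ₀)
    {v : RegIdx p ⊕ RegIdx p → ℝ}
    (hv : ∀ᵐ ω ∂P, ∑ a, regressorAt (X₂ 0 ω) (Q 0 ω) τ₀ a * U 0 ω * v a = 0) : v = 0 := by
  refine eq_zero_of_posDef_gram (w := fun a ω => regressorAt (X₂ 0 ω) (Q 0 ω) τ₀ a * U 0 ω)
    hdep.posDef_Omega (fun a b => ?_) (fun a b => ?_) hv
  · refine integral_congr_ae (ae_of_all _ fun ω => ?_)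
    simp only
    ring
  · refine ((memLp_envelope hX₂ hQ hU hdep).integrable one_le_two).mono'
      (((measurable_regressorAt hX₂ hQ τ₀ a).mul (hU 0)).mul
      ((measurable_regressorAt hX₂ hQ τ₀ b).mul (hU 0))).aestronglyMeasurable
      (ae_of_all _ fun ω => ?_)
    refine le_trans ?_ (sq_mul_le_envelope _)
    have ha := abs_regressorAt_le (X₂ 0 ω) (Q 0 ω) τ₀ a
    have hb := abs_regressorAt_le (X₂ 0 ω) (Q 0 ω) τ₀ b
    simp only [Real.norm_eq_abs, abs_mul, sq, obs]
    rw [mul_comm |regressorAt (X₂ 0 ω) (Q 0 ω) τ₀ a|, mul_comm |regressorAt (X₂ 0 ω) (Q 0 ω) τ₀ b|]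
    unfold X
    gcongr

/-- The errors do not vanish on either side of the threshold. -/
theorem integral_sq_error_pos {τ₀ : ℝ} (hX₂ : ∀ i, Measurable (X₂ i))
    (hQ : ∀ i, Measurable (Q i))
    (hU : ∀ i, Measurable (U i)) (hdep : DependenceAssumption P X₂ Q U τ₀) {S : Set ℝ}
    [DecidablePred (· ∈ S)] (hS : S = Set.Iic τ₀ ∨ S = Set.Ioi τ₀) :
    0 < ∫ ω, (if Q 0 ω ∈ S then U 0 ω ^ 2 else 0) ∂P := by
  have hSm : MeasurableSet S := by
    rcases hS with rfl | rfl
    exacts [measurableSet_Iic, measurableSet_Ioi]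
  have hint : Integrable (fun ω => if Q 0 ω ∈ S then U 0 ω ^ 2 else 0) P := by
    refine integrable_of_le_envelope hX₂ hQ hU hdep
      (φ := fun z => if z.1 iThr ∈ S then z.2 ^ 2 else 0) (C := 1)
      (Measurable.ite (((measurable_pi_apply _).comp measurable_fst) hSm) (by fun_prop)
        measurable_const) fun z hz => ?_
    rw [one_mul]
    split_ifs
    · rw [abs_of_nonneg (sq_nonneg _)]
      exact sq_le_envelope hz
    · rw [abs_zero]
      exact envelope_nonneg z
  have hnn : 0 ≤ fun ω => if Q 0 ω ∈ S then U 0 ω ^ 2 else 0 := fun ω => by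
    simp only [Pi.zero_apply]
    split_ifs
    exacts [sq_nonneg _, le_rfl]
  refine (integral_nonneg hnn).lt_of_ne fun h0 => ?_
  have hae := (integral_eq_zero_iff_of_nonneg hnn hint).1 h0.symm
  have hne : ∀ v : RegIdx p ⊕ RegIdx p → ℝ, v ≠ 0 →
      (∀ ω, ∑ a, regressorAt (X₂ 0 ω) (Q 0 ω) τ₀ a * U 0 ω * v a =
        if Q 0 ω ∈ S then U 0 ω else 0) → False := by
    intro v hv h
    refine hv (eq_zero_of_regressorAt_mul_error hX₂ hQ hU hdep ?_)
    filter_upwards [hae] with ω hω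
    rw [h]
    by_cases hq : Q 0 ω ∈ S
    · simpa [hq] using hω
    · simp [hq]
  -- Intercept coefficients `1` and `-1` in the two blocks produce the indicator of `Q ≤ τ₀`; the
  -- right-block intercept alone produces that of `Q > τ₀`.
  rcases hS with rfl | rfl
  · refine hne (Pi.single (Sum.inl iOne) 1 - Pi.single (Sum.inr iOne) 1) (fun h => ?_) fun ω => ?_
    · simpa using congrFun h (Sum.inl iOne)
    · simp only [Pi.sub_apply, mul_sub, Finset.sum_sub_distrib, Pi.single_apply, mul_ite, mul_one,
        mul_zero, Finset.sum_ite_eq', Finset.mem_univ, if_true, regressorAt, regressor,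
        Sum.elim_inl, Sum.elim_inr, Set.mem_Iic, ite_mul, one_mul, zero_mul]
      by_cases h : τ₀ < Q 0 ω
      · simp [h, h.not_ge]
      · simp [h, not_lt.1 h]
  · refine hne (Pi.single (Sum.inr iOne) 1) (fun h => ?_) fun ω => ?_
    · simpa using congrFun h (Sum.inr iOne)
    · simp only [Pi.single_apply, mul_ite, mul_one,
        mul_zero, Finset.sum_ite_eq', Finset.mem_univ, if_true, regressorAt, regressor,
        Sum.elim_inl, Sum.elim_inr, Set.mem_Ioi, ite_mul, one_mul, zero_mul]

end Model

/-! ### Identification of jumps. -/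

theorem eq_of_frequently_eq {F G : ℝ → ℝ} {t₀ : ℝ} (hF : ContinuousAt F t₀)
    (hG : ContinuousAt G t₀) (h : ∃ᶠ t in 𝓝 t₀, F t = G t) : F t₀ = G t₀ := by
  by_contra hne
  exact h ((hF.sub hG).eventually_ne (sub_ne_zero.2 hne) |>.mono fun t ht he =>
    ht (sub_eq_zero.2 he))

/-- A null vector of the conditional second moment matrix satisfies the kink restriction. -/
theorem isKink_of_condMoment {p : ℕ} {D : ℝ → Matrix (RegIdx p) (RegIdx p) ℝ} {t : ℝ} {α : Slope p}
    (hD1 : D t iOne iOne = 1) (hDt : ∀ a, D t a iThr = t * D t a iOne)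
    (h0 : ∀ a, ∑ b, D t a b * α (Sum.inr b) = 0) (hV : (condVar D t).PosDef) : IsKink (α, t) := by
  -- Given `Q = t` the threshold column is `t` times the intercept column, so only the jump size `δ₁
  -- + δ₃ t` and the middle coefficients enter.
  have hrow : ∀ a, D t a iOne * (α (Sum.inr iOne) + α (Sum.inr iThr) * t) +
      ∑ j, D t a (iMid j) * α (Sum.inr (iMid j)) = 0 := by
    intro a
    have h := h0 a
    simp only [Fintype.sum_sum_type, Finset.univ_unique, Finset.sum_singleton] at h
    have h' : D t a iOne * α (Sum.inr iOne) + (∑ j, D t a (iMid j) * α (Sum.inr (iMid j)) +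
      D t a iThr * α (Sum.inr iThr)) = 0 := h
    rw [hDt] at h'
    linarith
  have hone := hrow iOne
  rw [hD1, one_mul] at hone
  have hz : (fun j : Fin p => α (Sum.inr (iMid j))) = 0 := by
    by_contra hne
    have hp := hV.dotProduct_mulVec_pos hne
    have hmv : condVar D t *ᵥ (fun j : Fin p => α (Sum.inr (iMid j))) = 0 := by
      ext i
      simp only [Matrix.mulVec, dotProduct, condVar, Matrix.of_apply, sub_mul,
        Finset.sum_sub_distrib, Pi.zero_apply, mul_assoc, ← Finset.mul_sum]
      -- Eliminating the intercept row leaves the Schur complement, which is the conditional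
      -- variance.
      linear_combination hrow (iMid i) - D t (iMid i) iOne * hone
    rw [hmv] at hp
    simp at hp
  have hz' : ∀ j : Fin p, α (Sum.inr (iMid j)) = 0 := fun j => congrFun hz j
  refine ⟨?_, hz'⟩
  simpa [hz'] using hone

section Model

variable {Ω : Type*} [MeasurableSpace Ω] {P : Measure Ω} [IsProbabilityMeasure P] {p : ℕ}
  {X₂ : ℤ → Ω → Fin p → ℝ} {Q U : ℤ → Ω → ℝ}

theorem condMoment_thr {τ₀ : ℝ} (hX₂ : ∀ i, Measurable (X₂ i)) (hQ : ∀ i, Measurable (Q i))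
    (hU : ∀ i, Measurable (U i)) (hdep : DependenceAssumption P X₂ Q U τ₀)
    {D : ℝ → Matrix (RegIdx p) (RegIdx p) ℝ}
    (hD : ∀ a b, IsCondMean P (Q 0) (fun ω => X X₂ Q 0 ω a * X X₂ Q 0 ω b) (fun τ => D τ a b))
    (a : RegIdx p) : ∀ᵐ ω ∂P, D (Q 0 ω) a iThr = Q 0 ω * D (Q 0 ω) a iOne := by
  have hQm : StronglyMeasurable[MeasurableSpace.comap (Q 0) inferInstance] (Q 0) :=
    (comap_measurable (Q 0)).stronglyMeasurable
  have e : (fun ω => X X₂ Q 0 ω a * X X₂ Q 0 ω iThr) =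
      Q 0 * fun ω => X X₂ Q 0 ω a * X X₂ Q 0 ω iOne := by
    ext ω
    change X X₂ Q 0 ω a * Q 0 ω = Q 0 ω * (X X₂ Q 0 ω a * 1)
    ring
  have h := condExp_mul_of_stronglyMeasurable_left (μ := P) hQm
    (g := fun ω => X X₂ Q 0 ω a * X X₂ Q 0 ω iOne)
    (by rw [← e]; exact integrable_mul_X hX₂ hQ hU hdep a iThr)
    (integrable_mul_X hX₂ hQ hU hdep a iOne)
  rw [← e] at h
  filter_upwards [h, (hD a iThr).2, (hD a iOne).2] with ω h1 h2 h3
  rw [← h2, h1, Pi.mul_apply, h3]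

theorem condMoment_one (hQ : ∀ i, Measurable (Q i)) {D : ℝ → Matrix (RegIdx p) (RegIdx p) ℝ}
    (hD : ∀ a b, IsCondMean P (Q 0) (fun ω => X X₂ Q 0 ω a * X X₂ Q 0 ω b) (fun τ => D τ a b)) :
    ∀ᵐ ω ∂P, D (Q 0 ω) iOne iOne = 1 := by
  have e : (fun ω => X X₂ Q 0 ω iOne * X X₂ Q 0 ω iOne) = fun _ => (1 : ℝ) :=
    funext fun ω => one_mul (1 : ℝ)
  have h := (hD iOne iOne).2
  rw [e, condExp_const (hQ 0).comap_le] at h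
  filter_upwards [h] with ω hω using hω.symm

/-- Multiply the vanishing linear form by a regressor and condition on `Q`; the indicator of `Q ∈ I`
passes through the conditional expectation. -/
theorem condMoment_mulVec_eq_zero {τ₀ : ℝ} (hX₂ : ∀ i, Measurable (X₂ i))
    (hQ : ∀ i, Measurable (Q i)) (hU : ∀ i, Measurable (U i))
    (hdep : DependenceAssumption P X₂ Q U τ₀) {D : ℝ → Matrix (RegIdx p) (RegIdx p) ℝ}
    (hD : ∀ a b, IsCondMean P (Q 0) (fun ω => X X₂ Q 0 ω a * X X₂ Q 0 ω b) (fun τ => D τ a b))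
    {I : Set ℝ} (hI : MeasurableSet I) {v : RegIdx p → ℝ}
    (hv : ∀ᵐ ω ∂P, Q 0 ω ∈ I → X X₂ Q 0 ω ⬝ᵥ v = 0) (a : RegIdx p) :
    ∀ᵐ ω ∂P, Q 0 ω ∈ I → ∑ b, D (Q 0 ω) a b * v b = 0 := by
  have hint : ∀ b ∈ Finset.univ, Integrable (v b • fun ω => X X₂ Q 0 ω a * X X₂ Q 0 ω b) P :=
    fun b _ => (integrable_mul_X hX₂ hQ hU hdep a b).smul (v b)
  set W : Ω → ℝ := ∑ b, v b • fun ω => X X₂ Q 0 ω a * X X₂ Q 0 ω b with hW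
  have h1 : P[W | MeasurableSpace.comap (Q 0) inferInstance] =ᵐ[P]
      ∑ b, P[v b • fun ω => X X₂ Q 0 ω a * X X₂ Q 0 ω b |
        MeasurableSpace.comap (Q 0) inferInstance] :=
    condExp_finsetSum hint _
  have h2 : ∀ b, ∀ᵐ ω ∂P, (P[v b • fun ω => X X₂ Q 0 ω a * X X₂ Q 0 ω b |
      MeasurableSpace.comap (Q 0) inferInstance]) ω =
      v b * D (Q 0 ω) a b := fun b => by
    filter_upwards [condExp_smul (μ := P) (v b) (fun ω => X X₂ Q 0 ω a * X X₂ Q 0 ω b) _,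
      (hD a b).2] with ω h h'
    rw [h, Pi.smul_apply, h', smul_eq_mul]
  have h3 : P[(Q 0 ⁻¹' I).indicator W | MeasurableSpace.comap (Q 0) inferInstance] =ᵐ[P]
      (Q 0 ⁻¹' I).indicator (P[W | MeasurableSpace.comap (Q 0) inferInstance]) :=
    condExp_indicator (integrable_finsetSum' _ hint) ⟨I, hI, rfl⟩
  have h4 : (Q 0 ⁻¹' I).indicator W =ᵐ[P] 0 := by
    filter_upwards [hv] with ω hω
    by_cases hq : ω ∈ Q 0 ⁻¹' I
    · have h := hω hq
      rw [Set.indicator_of_mem hq, hW, Finset.sum_apply]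
      simp only [Pi.smul_apply, smul_eq_mul, Pi.zero_apply]
      rw [← mul_zero (X X₂ Q 0 ω a), ← h, dotProduct, Finset.mul_sum]
      exact Finset.sum_congr rfl fun b _ => by ring
    · rw [Set.indicator_of_notMem hq, Pi.zero_apply]
  have h5 := condExp_congr_ae (m := MeasurableSpace.comap (Q 0) inferInstance) h4
  rw [condExp_zero] at h5
  filter_upwards [h1, ae_all_iff.2 h2, h3, h5] with ω h1 h2 h3 h5 hq
  rw [h5, Set.indicator_of_mem (show ω ∈ Q 0 ⁻¹' I from hq), h1, Finset.sum_apply] at h3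
  simp only [h2, Pi.zero_apply] at h3
  rw [h3]
  exact Finset.sum_congr rfl fun b _ => mul_comm _ _

/-- A jump model is not observationally equivalent to a kink model. -/
theorem not_ae_fit_eq {T : Set ℝ} {τ₀ : ℝ} {α₀ : Slope p} (hX₂ : ∀ i, Measurable (X₂ i))
    (hQ : ∀ i, Measurable (Q i)) (hU : ∀ i, Measurable (U i))
    (hdep : DependenceAssumption P X₂ Q U τ₀) (hreg : RegularityAssumption P X₂ Q U T τ₀)
    (hτ₀ : τ₀ ∈ T) (hH₁ : IsJump (α₀, τ₀)) {θ : Param p} (hθ : θ.2 ∈ T) (hk : IsKink θ) :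
    ¬ ∀ᵐ ω ∂P, fit (α₀, τ₀) (X X₂ Q 0 ω) = fit θ (X X₂ Q 0 ω) := by
  intro hae
  obtain ⟨f, D, V, g, h, hf, hD, -, -, -, ⟨hfc, -, hDc⟩, ⟨-, hfpos⟩, ⟨-, hlow⟩, ⟨-, hvar⟩, -⟩ :=
    hreg
  have hnk : ¬ IsKink (α₀, τ₀) := by
    rintro ⟨h1, h2⟩
    rcases hH₁ with h | ⟨j, hj⟩
    exacts [h h1, hj (h2 j)]
  have hthr : ∀ ω, X X₂ Q 0 ω iThr = Q 0 ω := fun _ => rfl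
  have hzero : ∀ τ ∈ T, ∀ v : RegIdx p → ℝ,
      (∀ᵐ ω ∂P, Q 0 ω ≤ τ → X X₂ Q 0 ω ⬝ᵥ v = 0) → v = 0 := fun τ hτ v hv =>
    eq_zero_of_posDef_gram (w := fun a ω => X X₂ Q 0 ω a) (hlow τ hτ) (fun a b => rfl)
      (fun a b => (integrable_mul_X hX₂ hQ hU hdep a b).integrableOn)
      ((ae_restrict_iff' ((hQ 0) measurableSet_Iic)).2 hv)
  have hβ : α₀ ∘ Sum.inl = θ.1 ∘ Sum.inl := by
    rw [← sub_eq_zero]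
    -- Below both thresholds only the left block of coefficients acts, so positive definiteness of
    -- the lower moment identifies it.
    have hmin : min τ₀ θ.2 ∈ T := by
      rcases min_choice τ₀ θ.2 with e | e <;> rw [e] <;> assumption
    refine hzero _ hmin _ ?_
    filter_upwards [hae] with ω hω hq
    rw [le_min_iff] at hq
    simp only [fit, hthr, hq.1.not_gt, hq.2.not_gt, if_false, add_zero] at hω
    rw [dotProduct_sub, hω, sub_self]
  rcases le_or_gt θ.2 τ₀ with hle | hlt
  · have hδ : α₀ ∘ Sum.inr = θ.1 ∘ Sum.inr := by
      -- Above `τ₀` both indicators are on, so the right blocks agree too.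
      have h0 : (Sum.elim 0 (α₀ ∘ Sum.inr - θ.1 ∘ Sum.inr) : Slope p) = 0 := by
        refine eq_zero_of_regressorAt hX₂ hQ hU hdep ?_
        filter_upwards [hae] with ω hω
        simp only [fit, hthr, hβ, add_right_inj] at hω
        rw [Fintype.sum_sum_type]
        simp only [Sum.elim_inl, Sum.elim_inr, Pi.zero_apply, mul_zero,
          Finset.sum_const_zero, zero_add, regressorAt]
        by_cases hq : τ₀ < Q 0 ω
        · simp only [hq, hle.trans_lt hq, if_true] at hω ⊢
          change X X₂ Q 0 ω ⬝ᵥ (α₀ ∘ Sum.inr - θ.1 ∘ Sum.inr) = 0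
          rw [dotProduct_sub, hω, sub_self]
        · simp [hq]
      rw [← sub_eq_zero]
      exact funext fun a => congrFun h0 (Sum.inr a)
    have hδ' : ∀ a, α₀ (Sum.inr a) = θ.1 (Sum.inr a) := fun a => congrFun hδ a
    rcases hle.eq_or_lt with heq | hlt
    · refine hnk ⟨?_, fun j => ?_⟩
      · simp only [hδ', ← heq]
        exact hk.1
      · simp only [hδ']
        exact hk.2 j
    · have h3 : θ.1 (Sum.inr iThr) = 0 := by
        -- Between the thresholds only the hinge is active and it must vanish. A nonzero slope would
        -- make that interval null, against the positive density at `τ₀`. With zero slope the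
        -- restriction no longer depends on the threshold.
        by_contra hne
        refine hf.frequently_of_ae (hQ 0) (w := fun _ => False) (by simp) hlt ⟨hlt.le, le_rfl⟩
          hfc (hfpos _ hτ₀) ?_ (by simp)
        filter_upwards [hae] with ω hω hq
        simp only [fit, hthr, hβ, add_right_inj, hq.2.not_gt, if_false, hq.1, if_true] at hω
        rw [hk.dotProduct_eq rfl, hthr] at hω
        rcases mul_eq_zero.1 hω.symm with h | h
        · exact hne h
        · linarith [hq.1]
      refine hnk ⟨?_, fun j => ?_⟩
      · have h1 := hk.1
        simp only [hδ', h3, zero_mul, add_zero] at h1 ⊢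
        exact h1
      · simp only [hδ']
        exact hk.2 j
  · have hv : ∀ᵐ ω ∂P, Q 0 ω ∈ Set.Ioo τ₀ θ.2 → X X₂ Q 0 ω ⬝ᵥ (α₀ ∘ Sum.inr) = 0 := by
      filter_upwards [hae] with ω hω hq
      simpa only [fit, hthr, hβ, add_right_inj, hq.2.not_gt, if_false, hq.1, if_true] using hω
    have hDm : ∀ a b, Measurable fun t => D t a b := fun a b => (hD a b).1
    have hDc' : ∀ a b, ContinuousAt (fun t => D t a b) τ₀ := fun a b =>
      ((continuous_id.matrix_elem a b).continuousAt).comp hDc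
    have hm1 : MeasurableSet {t | D t iOne iOne = 1} :=
      measurableSet_eq_fun (hDm _ _) measurable_const
    have hm2 : MeasurableSet {t | ∀ a, D t a iThr = t * D t a iOne} := by
      rw [Set.ofPred_forall]
      exact MeasurableSet.iInter fun a =>
        measurableSet_eq_fun (hDm _ _) (measurable_id.mul (hDm _ _))
    have hm3 : MeasurableSet {t | ∀ a, ∑ b, D t a b * (α₀ ∘ Sum.inr) b = 0} := by
      rw [Set.ofPred_forall]
      exact MeasurableSet.iInter fun a => measurableSet_eq_fun
        (Finset.measurable_sum _ fun b _ => (hDm _ _).mul_const _) measurable_const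
    -- The true right block annihilates the regressor just above `τ₀`. The resulting conditional
    -- moment identities hold at points arbitrarily near `τ₀`, and continuity of `D` carries them to
    -- `τ₀` itself.
    have hfreq := hf.frequently_of_ae (hQ 0) (a := τ₀) (b := θ.2) (t₀ := τ₀)
      (w := fun t => D t iOne iOne = 1 ∧ (∀ a, D t a iThr = t * D t a iOne) ∧
        ∀ a, ∑ b, D t a b * (α₀ ∘ Sum.inr) b = 0)
      (hm1.inter (hm2.inter hm3))
      hlt ⟨le_rfl, hlt.le⟩ hfc (hfpos _ hτ₀)
      (by
        filter_upwards [condMoment_one hQ hD,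
          ae_all_iff.2 (condMoment_thr hX₂ hQ hU hdep hD),
          ae_all_iff.2 (condMoment_mulVec_eq_zero hX₂ hQ hU hdep hD measurableSet_Ioo hv)]
          with ω h1 h2 h3 hq
        exact ⟨h1, h2, fun a => h3 a hq⟩)
    refine hnk (isKink_of_condMoment (D := D) ?_ (fun a => ?_) (fun a => ?_) (hvar _ hτ₀))
    · exact eq_of_frequently_eq (hDc' _ _) continuousAt_const (hfreq.mono fun t h => h.1)
    · exact eq_of_frequently_eq (hDc' _ _) (continuousAt_id.mul (hDc' _ _))
        (hfreq.mono fun t h => h.2.1 a)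
    · exact eq_of_frequently_eq (F := fun t => ∑ b, D t a b * (α₀ ∘ Sum.inr) b)
        (tendsto_finsetSum _ fun b _ => (hDc' a b).mul_const _)
        continuousAt_const (hfreq.mono fun t h => h.2.2 a)

end Model

/-! ### Uniform bounds for the criterion. -/

theorem criterion_eq_sampleMean {Ω : Type*} {p : ℕ} {X₂ : ℤ → Ω → Fin p → ℝ}
    {Q U : ℤ → Ω → ℝ} (θ₀ : Param p) (n : ℕ) (ω : Ω) (θ : Param p) :
    criterion θ₀ X₂ Q U n ω θ =
      sampleMean (obs X₂ Q U) (fun z => (z.2 + (fit θ₀ z.1 - fit θ z.1)) ^ 2) n ω := by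
  unfold criterion sampleMean Y
  congr 1
  refine Finset.sum_congr rfl fun i _ => ?_
  rw [regFun_eq_fit, regFun_eq_fit]
  simp only [obs, X]
  ring

section Model

variable {Ω : Type*} [MeasurableSpace Ω] {P : Measure Ω} [IsProbabilityMeasure P] {p : ℕ}
  {X₂ : ℤ → Ω → Fin p → ℝ} {Q U : ℤ → Ω → ℝ}

/-- Over kink parameters the criterion exceeds its value at a jump parameter by a fixed amount. -/
theorem exists_excess_lower_bound {Λ : Set (Slope p)} {T : Set ℝ} {τ₀ : ℝ} {α₀ : Slope p}
    (hX₂ : ∀ i, Measurable (X₂ i))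
    (hQ : ∀ i, Measurable (Q i)) (hU : ∀ i, Measurable (U i)) (hΛ : IsCompact Λ) (hT : IsCompact T)
    (hdep : DependenceAssumption P X₂ Q U τ₀) (hreg : RegularityAssumption P X₂ Q U T τ₀)
    (hτ₀ : τ₀ ∈ T) (hH₁ : IsJump (α₀, τ₀)) :
    ∃ ε : ℝ, 0 < ε ∧ Tendsto (fun n : ℕ => P {ω | ∃ θ ∈ {θ | θ ∈ Λ ×ˢ T ∧ IsKink θ},
      sampleMean (obs X₂ Q U) (fun z => (fit (α₀, τ₀) z.1 - fit θ z.1) ^ 2 +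
        2 * z.2 * (fit (α₀, τ₀) z.1 - fit θ z.1)) n ω < ε}) atTop (𝓝 0) := by
  obtain ⟨R, hR⟩ := (hΛ.prod hT).isBounded.exists_norm_le
  set c := (Fintype.card (RegIdx p) : ℝ)
  set B : ℝ := 2 * c * ‖α₀‖ + 2 * c * |R|
  have hB : 0 ≤ B := by positivity
  have hd : ∀ θ ∈ {θ | θ ∈ Λ ×ˢ T ∧ IsKink θ}, ∀ x : RegIdx p → ℝ,
      |fit (α₀, τ₀) x - fit θ x| ≤ B * ‖x‖ := by
    intro θ hθ x
    have h1 := abs_fit_le (α₀, τ₀) x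
    have h2 : |fit θ x| ≤ 2 * c * |R| * ‖x‖ := (abs_fit_le θ x).trans (by
      gcongr
      exact (norm_fst_le θ).trans ((hR θ hθ.1).trans (le_abs_self R)))
    refine (abs_sub _ _).trans ?_
    simp only [B, add_mul]
    exact add_le_add h1 h2
  have hm : ∀ θ : Param p, Measurable fun x => fit (α₀, τ₀) x - fit θ x := fun θ =>
    (measurable_fit _).sub (measurable_fit _)
  have hmz : ∀ θ : Param p, Measurable fun z : (RegIdx p → ℝ) × ℝ =>
      (fit (α₀, τ₀) z.1 - fit θ z.1) ^ 2 + 2 * z.2 * (fit (α₀, τ₀) z.1 - fit θ z.1) := fun θ => by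
    have : Measurable fun z : (RegIdx p → ℝ) × ℝ => fit (α₀, τ₀) z.1 - fit θ z.1 :=
      (hm θ).comp measurable_fst
    exact (this.pow_const 2).add ((measurable_snd.const_mul 2).mul this)
  refine exists_uniform_lower_bound (Z := obs X₂ Q U) (L := (c + 1 + 2 * |R|) * (2 * B + 2))
    hdep.stationary_ergodic (measurable_obs hX₂ hQ hU) hdep.mixing
    (G := {z | z.1 iOne = 1}) (fun _ _ => rfl) measurable_envelope
    (memLp_envelope hX₂ hQ hU hdep) ((hΛ.prod hT).inter_right isClosed_setOf_isKink)
    (fun θ _ => hmz θ) (fun θ hθ => ?_) (fun θ hθ θ' hθ' z hz => ?_) envelope_nonneg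
    (fun θ hθ => ?_)
  · refine memLp_of_le_envelope hX₂ hQ hU hdep (hmz θ) (C := B ^ 2 + 2 * B) fun z hz => ?_
    have h := hd θ hθ z.1
    set d := fit (α₀, τ₀) z.1 - fit θ z.1
    refine (abs_add_le _ _).trans ?_
    rw [abs_pow, abs_mul, abs_mul, abs_two]
    calc _ ≤ (B * ‖z.1‖) ^ 2 + 2 * |z.2| * (B * ‖z.1‖) := by gcongr
      _ = B ^ 2 * ‖z.1‖ ^ 2 + 2 * B * (|z.2| * ‖z.1‖) := by ring
      _ ≤ B ^ 2 * envelope z + 2 * B * envelope z := by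
        gcongr
        exacts [sq_norm_le_envelope z, mul_norm_le_envelope hz]
      _ = _ := by ring
  · have hdd : |fit (α₀, τ₀) z.1 - fit θ z.1 - (fit (α₀, τ₀) z.1 - fit θ' z.1)| ≤
        (c + 1 + 2 * |R|) * dist θ θ' * ‖z.1‖ := by
      rw [sub_sub_sub_cancel_left, dist_comm]
      exact hθ'.2.abs_fit_sub_le hθ.2 ((hR θ' hθ'.1).trans (le_abs_self R))
        ((hR θ hθ.1).trans (le_abs_self R)) hz
    refine (excess_sub_le (norm_nonneg _) (by positivity) (hd θ hθ z.1) (hd θ' hθ' z.1) hdd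
      (u := z.2)).trans ?_
    calc _ ≤ (c + 1 + 2 * |R|) * dist θ θ' * (2 * B * envelope z + 2 * envelope z) := by
          gcongr
          exacts [sq_norm_le_envelope z, mul_norm_le_envelope hz]
      _ = _ := by ring
  · obtain ⟨hi, hi0⟩ := integral_mul_error_eq_zero hX₂ hQ hU hdep (hm θ) (hd θ hθ)
    have hi2 : Integrable (fun ω => (fit (α₀, τ₀) (X X₂ Q 0 ω) - fit θ (X X₂ Q 0 ω)) ^ 2) P := by
      refine integrable_of_le_envelope hX₂ hQ hU hdep
        (φ := fun z => (fit (α₀, τ₀) z.1 - fit θ z.1) ^ 2) (C := B ^ 2)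
        (((hm θ).comp measurable_fst).pow_const 2) fun z _ => ?_
      rw [abs_pow]
      calc _ ≤ (B * ‖z.1‖) ^ 2 := by gcongr; exact hd θ hθ z.1
        _ = B ^ 2 * ‖z.1‖ ^ 2 := by ring
        _ ≤ _ := by gcongr; exact sq_norm_le_envelope z
    -- The cross term integrates to zero by orthogonality of the errors.
    have e : ∫ ω, ((fit (α₀, τ₀) (obs X₂ Q U 0 ω).1 - fit θ (obs X₂ Q U 0 ω).1) ^ 2 +
        2 * (obs X₂ Q U 0 ω).2 * (fit (α₀, τ₀) (obs X₂ Q U 0 ω).1 - fit θ (obs X₂ Q U 0 ω).1)) ∂P =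
        ∫ ω, (fit (α₀, τ₀) (X X₂ Q 0 ω) - fit θ (X X₂ Q 0 ω)) ^ 2 ∂P := by
      have h := integral_add hi2 (hi.const_mul 2)
      rw [integral_const_mul, hi0, mul_zero, add_zero] at h
      rw [← h]
      refine integral_congr_ae (ae_of_all _ fun ω => ?_)
      simp only [obs]
      ring
    rw [e]
    refine (integral_nonneg fun ω => sq_nonneg _).lt_of_ne fun h0 => ?_
    refine not_ae_fit_eq hX₂ hQ hU hdep hreg hτ₀ hH₁ hθ.1.2 hθ.2 ?_
    filter_upwards [(integral_eq_zero_iff_of_nonneg (fun ω => sq_nonneg _) hi2).1 h0.symm]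
      with ω hω
    exact sub_eq_zero.1 (pow_eq_zero_iff two_ne_zero |>.1 hω)

/-- Linear regressions on the observations on one side of the threshold do not fit perfectly. -/
theorem exists_residual_lower_bound {τ₀ : ℝ} (hX₂ : ∀ i, Measurable (X₂ i))
    (hQ : ∀ i, Measurable (Q i)) (hU : ∀ i, Measurable (U i))
    (hdep : DependenceAssumption P X₂ Q U τ₀) {S : Set ℝ} [DecidablePred (· ∈ S)]
    (hS : S = Set.Iic τ₀ ∨ S = Set.Ioi τ₀) {K : Set (RegIdx p → ℝ)} (hK : IsCompact K) :
    ∃ ε : ℝ, 0 < ε ∧ Tendsto (fun n : ℕ => P {ω | ∃ b ∈ K, sampleMean (obs X₂ Q U)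
      (fun z => if z.1 iThr ∈ S then (z.2 + z.1 ⬝ᵥ b) ^ 2 else 0) n ω < ε}) atTop (𝓝 0) := by
  have hSm : MeasurableSet S := by
    rcases hS with rfl | rfl
    exacts [measurableSet_Iic, measurableSet_Ioi]
  obtain ⟨R, hR⟩ := hK.isBounded.exists_norm_le
  set c := (Fintype.card (RegIdx p) : ℝ)
  set B : ℝ := c * |R|
  have hB : 0 ≤ B := by positivity
  have hd : ∀ b ∈ K, ∀ x : RegIdx p → ℝ, |x ⬝ᵥ b| ≤ B * ‖x‖ := fun b hb x =>
    (abs_dotProduct_le x b).trans (by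
      rw [mul_comm ‖x‖, ← mul_assoc]
      refine mul_le_mul_of_nonneg_right ?_ (norm_nonneg x)
      refine mul_le_mul_of_nonneg_left ?_ (Nat.cast_nonneg _)
      exact (hR b hb).trans (le_abs_self R))
  have hm : ∀ b : RegIdx p → ℝ, Measurable fun z : (RegIdx p → ℝ) × ℝ =>
      if z.1 iThr ∈ S then (z.2 + z.1 ⬝ᵥ b) ^ 2 else 0 := fun b =>
    Measurable.ite (((measurable_pi_apply _).comp measurable_fst) hSm)
      ((measurable_snd.add ((measurable_dotProduct_const b).comp measurable_fst)).pow_const 2)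
      measurable_const
  have hle : ∀ b ∈ K, ∀ z : (RegIdx p → ℝ) × ℝ, z.1 iOne = 1 →
      |if z.1 iThr ∈ S then (z.2 + z.1 ⬝ᵥ b) ^ 2 else 0| ≤ (2 + 2 * B ^ 2) * envelope z := by
    intro b hb z hz
    split_ifs
    · rw [abs_of_nonneg (sq_nonneg _)]
      have h1 : (z.1 ⬝ᵥ b) ^ 2 ≤ (B * ‖z.1‖) ^ 2 := by
        rw [← sq_abs]
        gcongr
        exact hd b hb z.1
      have h2 : B ^ 2 * ‖z.1‖ ^ 2 ≤ B ^ 2 * envelope z := by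
        gcongr; exact sq_norm_le_envelope z
      have h3 := sq_le_envelope hz
      nlinarith [sq_nonneg (z.2 - z.1 ⬝ᵥ b)]
    · rw [abs_zero]
      exact mul_nonneg (by positivity) (envelope_nonneg z)
  refine exists_uniform_lower_bound (Z := obs X₂ Q U) (L := c * (2 * B + 2))
    hdep.stationary_ergodic (measurable_obs hX₂ hQ hU) hdep.mixing
    (G := {z | z.1 iOne = 1}) (fun _ _ => rfl) measurable_envelope
    (memLp_envelope hX₂ hQ hU hdep) hK (fun b _ => hm b)
    (fun b hb => memLp_of_le_envelope hX₂ hQ hU hdep (hm b) (hle b hb))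
    (fun b hb b' hb' z hz => ?_) envelope_nonneg (fun b hb => ?_)
  · have h0 : 0 ≤ c * (2 * B + 2) * dist b b' * envelope z :=
      mul_nonneg (by positivity) (envelope_nonneg z)
    split_ifs
    · have hdd : |z.1 ⬝ᵥ b - z.1 ⬝ᵥ b'| ≤ c * dist b b' * ‖z.1‖ := by
        rw [← dotProduct_sub, dist_eq_norm]
        refine (abs_dotProduct_le _ _).trans_eq ?_
        ring
      have h := excess_sub_le (norm_nonneg z.1) (by positivity) (hd b hb z.1) (hd b' hb' z.1) hdd
        (u := z.2)
      calc _ = ((z.1 ⬝ᵥ b) ^ 2 + 2 * z.2 * z.1 ⬝ᵥ b) -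
            ((z.1 ⬝ᵥ b') ^ 2 + 2 * z.2 * z.1 ⬝ᵥ b') := by ring
        _ ≤ _ := h
        _ ≤ c * dist b b' * (2 * B * envelope z + 2 * envelope z) := by
          gcongr
          exacts [sq_norm_le_envelope z, mul_norm_le_envelope hz]
        _ = _ := by ring
    · simpa using h0
  · obtain ⟨hi, hi0⟩ := integral_mul_error_eq_zero hX₂ hQ hU hdep
      (ψ := fun x => if x iThr ∈ S then x ⬝ᵥ b else 0) (C := B)
      (Measurable.ite ((measurable_pi_apply _) hSm) (measurable_dotProduct_const b)
        measurable_const) (fun x => by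
        split_ifs
        · exact hd b hb x
        · rw [abs_zero]; positivity)
    have hiU : Integrable (fun ω => if Q 0 ω ∈ S then U 0 ω ^ 2 else 0) P := by
      refine integrable_of_le_envelope hX₂ hQ hU hdep
        (φ := fun z => if z.1 iThr ∈ S then z.2 ^ 2 else 0) (C := 1)
        (Measurable.ite (((measurable_pi_apply _).comp measurable_fst) hSm) (by fun_prop)
          measurable_const) fun z hz => ?_
      rw [one_mul]
      split_ifs
      · rw [abs_of_nonneg (sq_nonneg _)]
        exact sq_le_envelope hz
      · rw [abs_zero]
        exact envelope_nonneg z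
    have hpos := integral_sq_error_pos hX₂ hQ hU hdep hS
    have h := integral_add hiU (hi.const_mul 2)
    rw [integral_const_mul, hi0, mul_zero, add_zero] at h
    rw [← h] at hpos
    -- Dropping the square of the fit, `(u + x'b)² ≥ u² + 2u x'b`, and the cross term has mean zero.
    refine hpos.trans_le (integral_mono (hiU.add (hi.const_mul 2))
      (integrable_of_le_envelope hX₂ hQ hU hdep (hm b) (hle b hb)) fun ω => ?_)
    have hthr : X X₂ Q 0 ω iThr = Q 0 ω := rfl
    simp only [obs, hthr]
    split_ifs
    · nlinarith [sq_nonneg (X X₂ Q 0 ω ⬝ᵥ b)]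
    · simp

end Model

/-! ### Decomposition of the criterion and consistency. -/

theorem criterion_self {Ω : Type*} {p : ℕ} {X₂ : ℤ → Ω → Fin p → ℝ} {Q U : ℤ → Ω → ℝ}
    (θ₀ : Param p) (n : ℕ) (ω : Ω) :
    criterion θ₀ X₂ Q U n ω θ₀ = sampleMean (obs X₂ Q U) (fun z => z.2 ^ 2) n ω := by
  simp [criterion_eq_sampleMean]

theorem criterion_eq_add {Ω : Type*} {p : ℕ} {X₂ : ℤ → Ω → Fin p → ℝ} {Q U : ℤ → Ω → ℝ}
    (θ₀ : Param p) (n : ℕ) (ω : Ω) (θ : Param p) :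
    criterion θ₀ X₂ Q U n ω θ = criterion θ₀ X₂ Q U n ω θ₀ +
      sampleMean (obs X₂ Q U) (fun z => (fit θ₀ z.1 - fit θ z.1) ^ 2 +
        2 * z.2 * (fit θ₀ z.1 - fit θ z.1)) n ω := by
  rw [criterion_self, criterion_eq_sampleMean]
  unfold sampleMean
  rw [← mul_add, ← Finset.sum_add_distrib]
  congr 1
  exact Finset.sum_congr rfl fun i _ => by ring

theorem sampleMean_mono {Ω E : Type*} {Z : ℤ → Ω → E} {φ ψ : E → ℝ} (h : ∀ z, φ z ≤ ψ z) (n : ℕ)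
    (ω : Ω) : sampleMean Z φ n ω ≤ sampleMean Z ψ n ω :=
  mul_le_mul_of_nonneg_left (Finset.sum_le_sum fun _ _ => h _) (by positivity)

/-- The criterion dominates the residuals of a linear regression on one side of `τ₀`. -/
theorem residual_le_criterion {Ω : Type*} {p : ℕ} {X₂ : ℤ → Ω → Fin p → ℝ} {Q U : ℤ → Ω → ℝ}
    {α₀ : Slope p} {τ₀ : ℝ} (n : ℕ) (ω : Ω) (θ : Param p) {S : Set ℝ} [DecidablePred (· ∈ S)]
    {b : RegIdx p → ℝ} (h : ∀ x : RegIdx p → ℝ, x iThr ∈ S → fit (α₀, τ₀) x - fit θ x = x ⬝ᵥ b) :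
    sampleMean (obs X₂ Q U) (fun z => if z.1 iThr ∈ S then (z.2 + z.1 ⬝ᵥ b) ^ 2 else 0) n ω ≤
      criterion (α₀, τ₀) X₂ Q U n ω θ := by
  rw [criterion_eq_sampleMean]
  refine sampleMean_mono (fun z => ?_) n ω
  split_ifs with hz
  · rw [h _ hz]
  · positivity

/-- The test is consistent against every fixed jump alternative. -/
theorem tendsto_prob_testStat_gt {Ω : Type*} [MeasurableSpace Ω] (P : Measure Ω) [IsProbabilityMeasure P]
    {p : ℕ} (X₂ : ℤ → Ω → Fin p → ℝ) (Q U : ℤ → Ω → ℝ)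
    (hX₂ : ∀ i, Measurable (X₂ i)) (hQ : ∀ i, Measurable (Q i)) (hU : ∀ i, Measurable (U i))
    (Λ : Set (Slope p)) (T : Set ℝ) (hΛ : IsCompact Λ) (hT : IsCompact T)
    (α₀ : Slope p) (τ₀ : ℝ) (hα₀ : α₀ ∈ Λ) (hτ₀ : τ₀ ∈ T)
    (hdep : DependenceAssumption P X₂ Q U τ₀)
    (hreg : RegularityAssumption P X₂ Q U T τ₀)
    (hH₁ : IsJump (α₀, τ₀))
    (θhat θtilde : ℕ → Ω → Param p)
    (hhat : ∀ n ω, IsArgmin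
      (criterion (α₀, τ₀) X₂ Q U n ω) (Λ ×ˢ T) (θhat n ω))
    (htilde : ∀ n ω, IsArgmin
      (criterion (α₀, τ₀) X₂ Q U n ω)
      {θ | θ ∈ Λ ×ˢ T ∧ IsKink θ} (θtilde n ω))
    (c : ℝ) :
    Tendsto
      (fun n : ℕ => P {ω | c < testStat (α₀, τ₀) X₂ Q U θhat θtilde n ω})
      atTop (𝓝 1) := by
  obtain ⟨ε, hε, hex⟩ := exists_excess_lower_bound hX₂ hQ hU hΛ hT hdep hreg hτ₀ hH₁
  obtain ⟨ε₁, hε₁, hlo⟩ := exists_residual_lower_bound hX₂ hQ hU hdep (Or.inl rfl)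
    (hΛ.image (f := fun α => α₀ ∘ Sum.inl - α ∘ Sum.inl) (by fun_prop))
  obtain ⟨ε₂, hε₂, hup⟩ := exists_residual_lower_bound hX₂ hQ hU hdep (Or.inr rfl)
    (hΛ.image (f := fun α => (α₀ ∘ Sum.inl + α₀ ∘ Sum.inr) - (α ∘ Sum.inl + α ∘ Sum.inr))
      (by fun_prop))
  have hlln := weak_law_of_mixing hdep.stationary_ergodic (measurable_obs hX₂ hQ hU) hdep.mixing
    (φ := fun z => z.2 ^ 2) (by fun_prop)
    (memLp_of_le_envelope hX₂ hQ hU hdep (φ := fun z => z.2 ^ 2) (C := 1) (by fun_prop) fun z hz => by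
      rw [one_mul, abs_of_nonneg (sq_nonneg _)]
      exact sq_le_envelope hz) one_pos
  set M := ∫ ω, U 0 ω ^ 2 ∂P + 1
  have hM : 0 < M := by
    have : 0 ≤ ∫ ω, U 0 ω ^ 2 ∂P := integral_nonneg fun ω => sq_nonneg _
    positivity
  have hbad := ((hex.add hlo).add hup).add hlln
  simp only [add_zero] at hbad
  have hlim := ENNReal.Tendsto.sub (tendsto_const_nhds (x := (1 : ENNReal)) (f := atTop (α := ℕ)))
    hbad (Or.inl ENNReal.one_ne_top)
  rw [tsub_zero] at hlim
  refine tendsto_of_tendsto_of_tendsto_of_le_of_le' hlim tendsto_const_nhds ?_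
    (Eventually.of_forall fun _ => prob_le_one)
  -- For such `n` the numerator bound `nε` exceeds `|c| M`; the absolute value covers negative `c`.
  filter_upwards [eventually_gt_atTop ⌈|c| * M / ε⌉₊] with n hn
  have hn' : |c| * M < n * ε := (div_lt_iff₀ hε).1 (Nat.lt_of_ceil_lt hn)
  -- The rejection event and the four bad events cover the whole space. Subadditivity needs no
  -- measurability, and none is assumed of the estimators.
  rw [tsub_le_iff_right, ← measure_univ (μ := P)]
  refine (measure_mono ?_).trans ((measure_union_le _ _).trans (add_le_add_right
    ((measure_union_le _ _).trans (add_le_add_left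
      ((measure_union_le _ _).trans (add_le_add_left (measure_union_le _ _) _)) _)) _))
  intro ω _
  by_contra hcon
  simp only [Set.mem_union, not_or, Set.mem_ofPred_eq, not_exists, not_and, not_lt, not_le] at hcon
  obtain ⟨hstat, ⟨⟨h1, h2⟩, h3⟩, h4⟩ := hcon
  refine absurd hstat (not_le.2 ?_)
  have hS₀ : criterion (α₀, τ₀) X₂ Q U n ω (α₀, τ₀) ≤ M := by
    rw [criterion_self]
    have := (abs_lt.1 h4).2
    exact (sub_lt_iff_lt_add'.1 this).le
  have hle : criterion (α₀, τ₀) X₂ Q U n ω (θhat n ω) ≤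
      criterion (α₀, τ₀) X₂ Q U n ω (α₀, τ₀) := (hhat n ω).2 _ ⟨hα₀, hτ₀⟩
  have hge : criterion (α₀, τ₀) X₂ Q U n ω (α₀, τ₀) + ε ≤
      criterion (α₀, τ₀) X₂ Q U n ω (θtilde n ω) := by
    rw [criterion_eq_add (α₀, τ₀) n ω (θtilde n ω)]
    have := h1 _ (htilde n ω).1
    linarith
  -- A fitted threshold at or above `τ₀` leaves both indicators off for `q ≤ τ₀`; one at or below
  -- leaves both on for `q > τ₀`.
  have hpos : 0 < criterion (α₀, τ₀) X₂ Q U n ω (θhat n ω) := by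
    have hΛ' := (hhat n ω).1.1
    rcases le_total τ₀ (θhat n ω).2 with h | h
    · refine hε₁.trans_le ((h2 _ ⟨_, hΛ', rfl⟩).trans
        (residual_le_criterion n ω _ fun x hx => ?_))
      have hx : x iThr ≤ τ₀ := hx
      simp only [fit, hx.not_gt, (hx.trans h).not_gt, if_false, add_zero, dotProduct_sub]
    · refine hε₂.trans_le ((h3 _ ⟨_, hΛ', rfl⟩).trans
        (residual_le_criterion n ω _ fun x hx => ?_))
      have hx : τ₀ < x iThr := hx
      simp only [fit, hx, h.trans_lt hx, if_true, dotProduct_sub, dotProduct_add]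
  unfold testStat
  rw [lt_div_iff₀ hpos]
  calc _ ≤ |c| * M := mul_le_mul (le_abs_self c) (hle.trans hS₀) hpos.le (abs_nonneg c)
    _ < n * ε := hn'
    _ ≤ _ := by gcongr; linarith

end ThresholdRegression

theorem theorem3 {Ω : Type*} [MeasurableSpace Ω] (P : Measure Ω) [IsProbabilityMeasure P]
    {p : ℕ} (X₂ : ℤ → Ω → Fin p → ℝ) (Q U : ℤ → Ω → ℝ)
    (hX₂ : ∀ i, Measurable (X₂ i)) (hQ : ∀ i, Measurable (Q i)) (hU : ∀ i, Measurable (U i))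
    (Λ : Set (ThresholdRegression.Slope p)) (T : Set ℝ) (hΛ : IsCompact Λ) (hT : IsCompact T)
    (α₀ : ThresholdRegression.Slope p) (τ₀ : ℝ) (hα₀ : α₀ ∈ Λ) (hτ₀ : τ₀ ∈ T)
    (hdep : ThresholdRegression.DependenceAssumption P X₂ Q U τ₀)
    (hreg : ThresholdRegression.RegularityAssumption P X₂ Q U T τ₀)
    (hH₁ : ThresholdRegression.IsJump (α₀, τ₀))
    (θhat θtilde : ℕ → Ω → ThresholdRegression.Param p)
    (hhat : ∀ n ω, ThresholdRegression.IsArgmin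
      (ThresholdRegression.criterion (α₀, τ₀) X₂ Q U n ω) (Λ ×ˢ T) (θhat n ω))
    (htilde : ∀ n ω, ThresholdRegression.IsArgmin
      (ThresholdRegression.criterion (α₀, τ₀) X₂ Q U n ω)
      {θ | θ ∈ Λ ×ˢ T ∧ ThresholdRegression.IsKink θ} (θtilde n ω))
    (c : ℝ) :
    Tendsto
      (fun n : ℕ => P {ω | c < ThresholdRegression.testStat (α₀, τ₀) X₂ Q U θhat θtilde n ω})
      atTop (𝓝 1) :=
  ThresholdRegression.tendsto_prob_testStat_gt P X₂ Q U hX₂ hQ hU Λ T hΛ hT α₀ τ₀ hα₀ hτ₀ hdep hreg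
    hH₁ θhat θtilde hhat htilde c
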